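/- **Theorem (smooth min-entropy of almost-product symmetric states).** All Hilbert spaces are finite-dimensional, $\log$ is the binary logarithm, and $\mathcal{P}(\mathcal{H})$ is the set of nonnegative operators on $\mathcal{H}$. Let $n \geq 1$ and $0 \leq r \leq \frac{1}{2} n$ be integers and let $\mathcal{H}, \mathcal{H}_X, \mathcal{H}_B$ be Hilbert spaces. Permutations $\pi$ of $\{1,\dots,n\}$ act on $\mathcal{H}^{\otimes n}$ by permuting the tensor factors. *Symmetric subspaces.* For $|\theta\rangle \in \mathcal{H}$ and $0 \le m \le n$, let $\mathrm{Sym}(\mathcal{H}^{\otimes n}, |\theta\rangle^{\otimes m})$ be the space of all vectors $|\Psi\rangle \in \mathcal{H}^{\otimes n}$ that are invariant under all permutations and are linear combinations of vectors of the form $\pi(|\theta\rangle^{\otimes m} \otimes |\tilde\Psi\rangle)$ with a permutation $\pi$ and $|\tilde\Psi\rangle \in \mathcal{H}^{\otimes n-m}$. *Entropies.* $H(\rho) = -\mathrm{tr}(\rho \log \rho)$, $H_{\max}(\rho) = \log \mathrm{rank}(\rho)$ and $h(p) = -p\log p-(1-p)\log(1-p)$. For $\rho_{AB} \in \mathcal{P}(\mathcal{H}_A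 \otimes \mathcal{H}_B)$ and $\sigma_B \in \mathcal{P}(\mathcal{H}_B)$ let $H_{\min}(\rho_{AB}|\sigma_B) = -\log\lambda$, where $\lambda$ is the minimum real number such that $\lambda \cdot \mathrm{id}_A \otimes \sigma_B - \rho_{AB}$ is nonnegative; it is $-\infty$ if there is no such $\lambda$ and $+\infty$ if $\lambda = 0$. For $\varepsilon \ge 0$ let $$H_{\min}^\varepsilon(\rho_{AB}|B) = \sup_{\sigma_B} \sup_{\bar\rho_{AB}} H_{\min}(\bar\rho_{AB}|\sigma_B) \in [-\infty, \infty],$$ where $\sigma_B$ ranges over the density operators on $\mathcal{H}_B$ and $\bar\rho_{AB}$ over the nonnegative operators with $\|\bar\rho_{AB} - \rho_{AB}\|_1 \le \varepsilon \cdot \mathrm{tr}(\rho_{AB})$ and $\mathrm{tr}(\bar\rho_{AB}) \le \mathrm{tr}(\rho_{AB})$. *Statement.* Let $|\theta\rangle \in \mathcal{H}$ and $|\Psi\rangle \in \mathrm{Sym}(\mathcal{H}^{\otimes n}, |\theta\rangle^{\otimes n-r})$ be normalized. Let $\mathcal{E}$ be a trace-preserving completely positive map from operators on $\mathcal{H}$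 to operators on $\mathcal{H}_X \otimes \mathcal{H}_B$ which is classical on $\mathcal{H}_X$, i.e., $\mathcal{E}(S) = \sum_x |x\rangle\langle x| \otimes \mathcal{E}^x(S)$ for an orthonormal basis $\{|x\rangle\}_x$ of $\mathcal{H}_X$ and completely positive maps $\mathcal{E}^x$. Put $\rho_{X^nB^n} = \mathcal{E}^{\otimes n}(|\Psi\rangle\langle\Psi|)$ and $\sigma_{XB} = \mathcal{E}(|\theta\rangle\langle\theta|)$, with $\sigma_X = \mathrm{tr}_B\,\sigma_{XB}$ and $\sigma_B = \mathrm{tr}_X\,\sigma_{XB}$. Then, for every $\varepsilon \geq 0$, $$\frac{1}{n} H_{\min}^\varepsilon(\rho_{X^nB^n}|B^n) \;\geq\; H(\sigma_{XB}) - H(\sigma_B) - \delta, \qquad \delta = \Bigl(\tfrac{5}{2} H_{\max}(\sigma_X) + 4\Bigr)\sqrt{\frac{2\log(4/\varepsilon)}{n} + h(r/n)}.$$ Here $\delta = \infty$ for $\varepsilon = 0$, and the square root of a negative number (possible only for $\varepsilon > 4$, where the left-hand side is $+\infty$) is read as $0$. -/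

import Mathlib

open scoped Kronecker ComplexOrder

noncomputable section

/-! Finite-dimensional quantum systems in coordinates: a Hilbert space of dimension `|d|` is
`EuclideanSpace ℂ d`, operators on it are the matrices `Matrix d d ℂ`, the tensor product of two
systems has index type `d × e`, and `n`-fold tensor powers have index type `Fin n → d`. -/

/-- The projector `|ψ⟩⟨ψ|` onto a (normalized) vector. -/
def ketBra {d : Type*} (ψ : EuclideanSpace ℂ d) : Matrix d d ℂ :=
  Matrix.of fun i j => ψ i * star (ψ j)

/-- Partial trace over the second tensor factor. -/
def traceSnd {a b : Type*} [Fintype b] (ρ : Matrix (a × b) (a × b) ℂ) : Matrix a a ℂ :=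
  Matrix.of fun i j => ∑ k, ρ (i, k) (j, k)

/-- Partial trace over the first tensor factor. -/
def traceFst {a b : Type*} [Fintype a] (ρ : Matrix (a × b) (a × b) ℂ) : Matrix b b ℂ :=
  Matrix.of fun i j => ∑ k, ρ (k, i) (k, j)

/-! ### Quantum operations -/

/-- The extension `E ⊗ id` of a linear map on operators, `id` acting on the operators on `ℂ^k`. -/
def ampliation {d e k : Type*}
    (E : Matrix d d ℂ →ₗ[ℂ] Matrix e e ℂ) (M : Matrix (d × k) (d × k) ℂ) :
    Matrix (e × k) (e × k) ℂ :=
  Matrix.of fun p q => E (Matrix.of fun i j => M (i, p.2) (j, q.2)) p.1 q.1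

/-- Complete positivity: every extension `E ⊗ id` maps nonnegative operators to nonnegative
operators. -/
def IsCPM {d e : Type*} (E : Matrix d d ℂ →ₗ[ℂ] Matrix e e ℂ) : Prop :=
  ∀ (k : ℕ) (M : Matrix (d × Fin k) (d × Fin k) ℂ), M.PosSemidef → (ampliation E M).PosSemidef

def IsTracePreserving {d e : Type*} [Fintype d] [Fintype e]
    (E : Matrix d d ℂ →ₗ[ℂ] Matrix e e ℂ) : Prop :=
  ∀ S : Matrix d d ℂ, (E S).trace = S.trace

/-- `E` is classical on the first output system: for some orthonormal basis `|x⟩` of it,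
`E(S) = ∑ x, |x⟩⟨x| ⊗ E^x(S)` with completely positive maps `E^x`. -/
def IsClassicalOnFst {d X B : Type*} [Fintype X]
    (E : Matrix d d ℂ →ₗ[ℂ] Matrix (X × B) (X × B) ℂ) : Prop :=
  ∃ (e : OrthonormalBasis X ℂ (EuclideanSpace ℂ X)) (F : X → (Matrix d d ℂ →ₗ[ℂ] Matrix B B ℂ)),
    (∀ x, IsCPM (F x)) ∧ ∀ S, E S = ∑ x, ketBra (e x) ⊗ₖ F x S

/-- The tensor power `E^{⊗n}`: the linear map that sends `⊗ᵢ |aᵢ⟩⟨bᵢ|` to `⊗ᵢ E(|aᵢ⟩⟨bᵢ|)`. -/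
def tensorPowMap {d e : Type*} [Fintype d] [DecidableEq d]
    (E : Matrix d d ℂ →ₗ[ℂ] Matrix e e ℂ) (n : ℕ) (M : Matrix (Fin n → d) (Fin n → d) ℂ) :
    Matrix (Fin n → e) (Fin n → e) ℂ :=
  Matrix.of fun x y =>
    ∑ a : Fin n → d, ∑ b : Fin n → d,
      M a b * ∏ i, E (Matrix.single (a i) (b i) 1) (x i) (y i)

/-- Reordering of the tensor factors, `(A ⊗ B)^{⊗n} ≅ A^{⊗n} ⊗ B^{⊗n}`. -/
def splitPow {a b : Type*} {n : ℕ} (M : Matrix (Fin n → a × b) (Fin n → a × b) ℂ) :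
    Matrix ((Fin n → a) × (Fin n → b)) ((Fin n → a) × (Fin n → b)) ℂ :=
  Matrix.of fun p q => M (fun i => (p.1 i, p.2 i)) (fun i => (q.1 i, q.2 i))

/-! ### Symmetric subspaces -/

/-- The unitary `π (θ₁ ⊗ ⋯ ⊗ θₙ) = θ_{π⁻¹(1)} ⊗ ⋯ ⊗ θ_{π⁻¹(n)}` on the `n`-fold tensor power. -/
def permuteFactors {d : Type*} {n : ℕ} (π : Equiv.Perm (Fin n))
    (Ψ : EuclideanSpace ℂ (Fin n → d)) : EuclideanSpace ℂ (Fin n → d) :=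
  WithLp.toLp 2 fun x => Ψ fun i => x (π i)

/-- The symmetric subspace of the `n`-fold tensor power. -/
def symSubspace (d : Type*) (n : ℕ) : Submodule ℂ (EuclideanSpace ℂ (Fin n → d)) where
  carrier := {Ψ | ∀ π : Equiv.Perm (Fin n), permuteFactors π Ψ = Ψ}
  add_mem' := by
    intro Φ Ψ hΦ hΨ π
    have h1 := hΦ π
    have h2 := hΨ π
    ext x
    have e1 := congrArg (fun v => v x) h1
    have e2 := congrArg (fun v => v x) h2
    simp only [permuteFactors] at e1 e2 ⊢
    simp [e1, e2]
  zero_mem' := by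
    intro π
    ext x
    simp [permuteFactors]
  smul_mem' := by
    intro c Ψ hΨ π
    ext x
    have e1 := congrArg (fun v => v x) (hΨ π)
    simp only [permuteFactors] at e1 ⊢
    simp [e1]

/-- The vector `θ^{⊗m} ⊗ χ` of the `n`-fold tensor power (`m ≤ n`); the `n - m` factors on which
`χ` lives are the positions `m, …, n - 1`. -/
def tensorPowTensor {d : Type*} {n : ℕ} (θ : EuclideanSpace ℂ d) (m : ℕ)
    (χ : EuclideanSpace ℂ ({i : Fin n // m ≤ i.val} → d)) : EuclideanSpace ℂ (Fin n → d) :=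
  WithLp.toLp 2 fun x => (∏ i : {i : Fin n // i.val < m}, θ (x i)) * χ fun j => x j

/-- The vectors that have the form `θ^{⊗m} ⊗ χ` after some reordering of the `n` factors. -/
def almostProductVectors {d : Type*} (n : ℕ) (θ : EuclideanSpace ℂ d) (m : ℕ) :
    Set (EuclideanSpace ℂ (Fin n → d)) :=
  {Ψ | ∃ (π : Equiv.Perm (Fin n)) (χ : EuclideanSpace ℂ ({i : Fin n // m ≤ i.val} → d)),
    Ψ = permuteFactors π (tensorPowTensor θ m χ)}

/-- The symmetric subspace of the `n`-fold tensor power along `θ^{⊗m}`. -/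
def symSubspaceAlong {d : Type*} (n : ℕ) (θ : EuclideanSpace ℂ d) (m : ℕ) :
    Submodule ℂ (EuclideanSpace ℂ (Fin n → d)) :=
  symSubspace d n ⊓ Submodule.span ℂ (almostProductVectors n θ m)

/-! ### Entropies (all logarithms are binary) -/

/-- The trace norm `tr |S|` of a Hermitian operator `S`. -/
def traceNorm {d : Type*} [Fintype d] [DecidableEq d] (S : Matrix d d ℂ) : ℝ :=
  (cfc (fun x : ℝ => |x|) S).trace.re

/-- The von Neumann entropy `-tr (ρ log ρ)`. -/
def vonNeumannEntropy {d : Type*} [Fintype d] [DecidableEq d] (ρ : Matrix d d ℂ) : ℝ :=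
  (cfc Real.negMulLog ρ).trace.re / Real.log 2

/-- The max-entropy `log rank ρ` of an operator on a single system. -/
def maxEntropy {d : Type*} [Fintype d] (ρ : Matrix d d ℂ) : ℝ :=
  Real.logb 2 ρ.rank

/-- The binary Shannon entropy `-p log p - (1 - p) log (1 - p)`. -/
def binaryEntropy (p : ℝ) : ℝ :=
  -p * Real.logb 2 p - (1 - p) * Real.logb 2 (1 - p)

/-- The min-entropy of `ρ` relative to `σ`: it is `-log t` for the smallest real `t` such that
`t • (1 ⊗ σ) - ρ` is nonnegative. It is `⊤` if the smallest `t` is `0` (that is, `ρ = 0`), and `⊥`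
if there is no such `t`. For nonnegative `σ` the admissible `t` are closed upwards, so the value is the
supremum below, see `minEntropyRel_eq_of_isLeast`. -/
def minEntropyRel {a b : Type*} [DecidableEq a]
    (ρ : Matrix (a × b) (a × b) ℂ) (σ : Matrix b b ℂ) : EReal :=
  ⨆ (t : ℝ) (_ : 0 < t ∧ (t • ((1 : Matrix a a ℂ) ⊗ₖ σ) - ρ).PosSemidef),
    ((-Real.logb 2 t : ℝ) : EReal)

theorem minEntropyRel_eq_of_isLeast {a b : Type*} [DecidableEq a]
    (ρ : Matrix (a × b) (a × b) ℂ) (σ : Matrix b b ℂ) (t : ℝ) (ht : 0 < t)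
    (h : IsLeast {s : ℝ | (s • ((1 : Matrix a a ℂ) ⊗ₖ σ) - ρ).PosSemidef} t) :
    minEntropyRel ρ σ = ((-Real.logb 2 t : ℝ) : EReal) := by
  apply le_antisymm
  · refine iSup₂_le fun s hs => ?_
    have hle : t ≤ s := h.2 hs.2
    exact EReal.coe_le_coe_iff.2
      (neg_le_neg (Real.logb_le_logb_of_le (by norm_num) ht hle))
  · exact le_iSup₂ (f := fun (s : ℝ)
      (_ : 0 < s ∧ (s • ((1 : Matrix a a ℂ) ⊗ₖ σ) - ρ).PosSemidef) =>
        ((-Real.logb 2 s : ℝ) : EReal)) t ⟨ht, h.1⟩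

/-- The set of nonnegative operators `ρ'` with `‖ρ' - ρ‖₁ ≤ tr ρ · ε` and `tr ρ' ≤ tr ρ`. -/
def smoothingBall {d : Type*} [Fintype d] [DecidableEq d] (ε : ℝ) (ρ : Matrix d d ℂ) :
    Set (Matrix d d ℂ) :=
  {ρ' | ρ'.PosSemidef ∧ traceNorm (ρ' - ρ) ≤ ρ.trace.re * ε ∧ ρ'.trace.re ≤ ρ.trace.re}

/-- The `ε`-smooth min-entropy of `ρ` relative to `σ`. -/
def smoothMinEntropyRel {a b : Type*} [Fintype a] [DecidableEq a] [Fintype b] [DecidableEq b]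
    (ε : ℝ) (ρ : Matrix (a × b) (a × b) ℂ) (σ : Matrix b b ℂ) : EReal :=
  ⨆ ρ' ∈ smoothingBall ε ρ, minEntropyRel ρ' σ

/-- The `ε`-smooth min-entropy of `ρ` given the second system: the supremum of the relative
`ε`-smooth min-entropy over all density operators `σ` on that system. -/
def smoothMinEntropy {a b : Type*} [Fintype a] [DecidableEq a] [Fintype b] [DecidableEq b]
    (ε : ℝ) (ρ : Matrix (a × b) (a × b) ℂ) : EReal :=
  ⨆ (σ : Matrix b b ℂ) (_ : σ.PosSemidef ∧ σ.trace = 1), smoothMinEntropyRel ε ρ σ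

/-- The error term `(5/2 Hmax + 4) √(2 log(4/ε) / n + h(r/n))`, with the usual convention
`log(4/0) = ∞` for `ε = 0`. -/
def symErrorTerm (Hmax : ℝ) (n r : ℕ) (ε : ℝ) : EReal :=
  if ε = 0 then ⊤
  else (((5 / 2 * Hmax + 4) *
    √(2 * Real.logb 2 (4 / ε) / n + binaryEntropy ((r : ℝ) / n)) : ℝ) : EReal)

end

/-!
Why the bound holds. The map `E` is written with Kraus operators, so that the output state is
`A Aᴴ`, where the columns of `A` are the images of `Ψ` under tensor products of Kraus operators.

* *Decomposition* (`exists_decomposition`). Projecting each tensor factor onto `θ` or onto its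
  orthogonal complement writes `Ψ` as an orthogonal sum of `n.choose r ≤ 2 ^ (n h(r/n))` vectors
  `θ^{⊗Tᶜ} ⊗ β_T`, one for each `r`-element set `T` of factors. Correspondingly `A = ∑ A_T`, and
  `A_T A_Tᴴ` is a product of `n - r` copies of `S = E(|θ⟩⟨θ|)` and of some operator on the other
  `r` factors.
* *Smoothing* (`exists_smoothing`). For spectral decompositions `S = ∑ p_a |u_a⟩⟨u_a|` and
  `G = ∑ q_b |v_b⟩⟨v_b|`, damp the component of `u_a` along `v_b` by `min(1, q_b / p_a)`. The
  resulting operator `M` satisfies `M S Mᴴ ≤ G`, because the kernel `min(q_b, p_a)` is positive and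
  hence, by the Schur product theorem, so is its entrywise product with a positive block matrix. The
  squared distance by which factors of `S` move is at most `∑ w_ab (p_a / q_b) ^ s`, where
  `w_ab = p_a |⟨v_b, u_a⟩| ^ 2` is a probability distribution. This needs no operator convexity
  and, on tensor powers, reduces everything to sums of independent random variables.
* *Moments* (`exists_likelihood_ratio`, `moment_le_exp`). For `G = 1 ⊗ S_B`, the likelihood ratio
  `p / q` has mean at most `1` (since `S ≤ 1 ⊗ S_B` by classicality), its inverse has mean at most
  `D = rank S_X`, and its logarithm has mean `-log 2 (H(S) - H(S_B))`. A second order expansion in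
  `s`, with the remainder estimated by Jensen's inequality, bounds the `s`-th moment.
* *Assembly* (`exists_smoothing_output`). Replace each `A_T` by its smoothed version, which acts on
  the copies of `S` only; the other `r` factors obey `ω ≤ 1 ⊗ ω_B` by classicality
  (`posSemidef_idTrace_sub_krausPow`). Operator convexity of `A ↦ A Aᴴ` and the Cauchy–Schwarz
  inequality recombine the terms at the price of a factor `n.choose r`, both in the operator bound
  and in the squared distance.

With `s = √Λ / log (4 D)`, where `Λ` is the radicand of the error term, the distance is at most `ε`
(`choose_mul_failure_le`) and the losses add up to the error term (`le_neg_logb_choose_mul`).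
-/

set_option linter.unusedSectionVars false

namespace AlmostProduct

open Matrix

/-! ### Scalar estimates -/

theorem exp_sub_self_le {x a : ℝ} (h : |x| ≤ a) : Real.exp x - x ≤ Real.exp a - a := by
  have h1 : Real.exp x - x ≤ Real.exp |x| - |x| := by
    rcases le_total 0 x with hx | hx
    · rw [abs_of_nonneg hx]
    · rw [abs_of_nonpos hx]
      have := Real.self_le_sinh_iff.2 (neg_nonneg.2 hx)
      rw [Real.sinh_eq, neg_neg] at this
      linarith
  refine h1.trans ?_
  have h2 : Real.exp a = Real.exp |x| * Real.exp (a - |x|) := by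
    rw [← Real.exp_add]; congr 1; ring
  have h3 := Real.add_one_le_exp (a - |x|)
  have h4 : 1 ≤ Real.exp |x| := Real.one_le_exp (abs_nonneg x)
  nlinarith

/-- The constant `3 / 4` is a convenient upper bound for `e - 2`; what matters for the final error
term is that `3 / 2 - 3 / 4` exceeds `log 2`. -/
theorem exp_sub_sub_one_le {x : ℝ} (h0 : 0 ≤ x) (h1 : x ≤ 1) :
    Real.exp x - x - 1 ≤ 3 / 4 * x ^ 2 := by
  have := Real.exp_bound' h0 h1 (n := 2) (by norm_num)
  norm_num [Finset.sum_range_succ, Nat.factorial] at this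
  linarith

/-- The second order remainder of `φ ^ s` in `s` is controlled by the one at
`φ + φ⁻¹ + 2 = (√φ + 1 / √φ) ^ 2`, a point that is always at least `4`. -/
theorem rpow_le_linear_add {φ s : ℝ} (hφ : 0 < φ) (hs : 0 ≤ s) :
    φ ^ s ≤ s * Real.log φ
      + ((φ + φ⁻¹ + 2) ^ s - s * Real.log (φ + φ⁻¹ + 2)) := by
  have hinv : 0 < φ⁻¹ := inv_pos.2 hφ
  have hu : 0 < φ + φ⁻¹ + 2 := by positivity
  have habs : |Real.log φ| ≤ Real.log (φ + φ⁻¹ + 2) := by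
    refine abs_le.2 ⟨?_, Real.log_le_log hφ (by linarith)⟩
    have := Real.log_le_log hinv (show φ⁻¹ ≤ φ + φ⁻¹ + 2 by linarith)
    rw [Real.log_inv] at this
    linarith
  have h := exp_sub_self_le (x := Real.log φ * s) (a := Real.log (φ + φ⁻¹ + 2) * s)
    (by rw [abs_mul, abs_of_nonneg hs]; gcongr)
  rw [Real.rpow_def_of_pos hφ, Real.rpow_def_of_pos hu]
  linarith

theorem one_le_one_sub_mul_rpow {s x : ℝ} (h0 : 0 ≤ s) (h1 : s ≤ 1 / 2) (hx : 4 ≤ x) :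
    1 ≤ (1 - s) * x ^ s := by
  have h := rpow_one_add_le_one_add_mul_self (s := -(1 / 2)) (by norm_num)
    (p := 2 * s) (by linarith) (by linarith)
  have e : (1 + -(1 / 2) : ℝ) ^ (2 * s) = ((4 : ℝ) ^ s)⁻¹ := by
    rw [Real.rpow_mul (by norm_num), ← Real.inv_rpow (by norm_num)]
    norm_num
  rw [e] at h
  have h4 : 0 < (4 : ℝ) ^ s := by positivity
  calc (1 : ℝ) = ((4 : ℝ) ^ s)⁻¹ * 4 ^ s := by field_simp
    _ ≤ (1 - s) * x ^ s := by
      refine mul_le_mul (by linarith) (Real.rpow_le_rpow (by norm_num) hx h0) h4.le (by linarith)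

/-- For `s = 1 / 2` the second derivative changes sign exactly at `4`, which is why the shift by `2`
is needed in `rpow_le_linear_add`. -/
theorem concaveOn_rpow_sub_log {s : ℝ} (h0 : 0 ≤ s) (h1 : s ≤ 1 / 2) :
    ConcaveOn ℝ (Set.Ici 4) fun u : ℝ => u ^ s - s * Real.log u := by
  have hpos : ∀ x ∈ interior (Set.Ici (4 : ℝ)), 4 < x := by
    intro x hx; rwa [interior_Ici] at hx
  refine concaveOn_of_hasDerivWithinAt2_nonpos (convex_Ici 4)
    (f' := fun u => s * u ^ (s - 1) - s * u⁻¹)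
    (f'' := fun u => s * ((s - 1) * u ^ (s - 1 - 1)) - s * (-(u ^ 2)⁻¹)) ?_ ?_ ?_ ?_
  · intro x hx
    have hx' : (0 : ℝ) < x := lt_of_lt_of_le (by norm_num) hx
    exact ((Real.continuousAt_rpow_const x s (Or.inl hx'.ne')).sub
      (continuousAt_const.mul (Real.continuousAt_log hx'.ne'))).continuousWithinAt
  · intro x hx
    have hx' : (0 : ℝ) < x := by linarith [hpos x hx]
    exact ((Real.hasDerivAt_rpow_const (Or.inl hx'.ne')).sub
      ((Real.hasDerivAt_log hx'.ne').const_mul s)).hasDerivWithinAt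
  · intro x hx
    have hx' : (0 : ℝ) < x := by linarith [hpos x hx]
    exact (((Real.hasDerivAt_rpow_const (Or.inl hx'.ne')).const_mul s).sub
      ((hasDerivAt_inv hx'.ne').const_mul s)).hasDerivWithinAt
  · intro x hx
    have hx' : (0 : ℝ) < x := by linarith [hpos x hx]
    have h := one_le_one_sub_mul_rpow h0 h1 (hpos x hx).le
    have e : x ^ (s - 1 - 1) = x ^ s * (x ^ 2)⁻¹ := by
      rw [sub_sub, Real.rpow_sub hx']
      norm_num [div_eq_mul_inv]
    rw [e]
    have : 0 ≤ s * (x ^ 2)⁻¹ := by positivity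
    nlinarith

theorem rpow_sub_log_mono {s u v : ℝ} (hs : 0 ≤ s) (hu : 1 ≤ u) (huv : u ≤ v) :
    u ^ s - s * Real.log u ≤ v ^ s - s * Real.log v := by
  have hu0 : 0 < u := by linarith
  have h := exp_sub_self_le (x := Real.log u * s) (a := Real.log v * s) (by
    rw [abs_of_nonneg (mul_nonneg (Real.log_nonneg hu) hs)]
    exact mul_le_mul_of_nonneg_right (Real.log_le_log hu0 huv) hs)
  rw [Real.rpow_def_of_pos hu0, Real.rpow_def_of_pos (hu0.trans_le huv)]
  linarith

/-- The case of `moment_le_exp` in which `φ` is positive everywhere. -/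
theorem moment_le_exp_of_pos {Ω : Type*} [Fintype Ω] {w φ : Ω → ℝ} {D s : ℝ}
    (hw : ∀ i, 0 ≤ w i) (hφ : ∀ i, 0 < φ i) (hsum : ∑ i, w i = 1)
    (h₁ : ∑ i, w i * φ i ≤ 1) (h₂ : ∑ i, w i * (φ i)⁻¹ ≤ D) (hD : 1 ≤ D)
    (hs0 : 0 ≤ s) (hs1 : s ≤ 1 / 2) (hx : s * Real.log (4 * D) ≤ 1) :
    ∑ i, w i * φ i ^ s
      ≤ Real.exp (s * ∑ i, w i * Real.log (φ i) + 3 / 4 * (s * Real.log (4 * D)) ^ 2) := by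
  have hu4 : ∀ i, 4 ≤ φ i + (φ i)⁻¹ + 2 := by
    intro i
    have h := hφ i
    have : φ i + (φ i)⁻¹ + 2 - 4 = (φ i - 1) ^ 2 / φ i := by field_simp; ring
    have : 0 ≤ (φ i - 1) ^ 2 / φ i := by positivity
    linarith
  have hJ := (concaveOn_rpow_sub_log hs0 hs1).le_map_sum (t := Finset.univ) (w := w)
    (p := fun i => φ i + (φ i)⁻¹ + 2) (fun i _ => hw i) hsum (fun i _ => hu4 i)
  simp only [smul_eq_mul] at hJ
  -- the mean is at most `1 + D + 2`
  have hv : ∑ i, w i * (φ i + (φ i)⁻¹ + 2) ≤ 4 * D := by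
    simp only [mul_add, Finset.sum_add_distrib, ← Finset.sum_mul, hsum]
    linarith
  have hv4 : 4 ≤ ∑ i, w i * (φ i + (φ i)⁻¹ + 2) := by
    calc (4 : ℝ) = ∑ i, w i * 4 := by rw [← Finset.sum_mul, hsum, one_mul]
      _ ≤ _ := Finset.sum_le_sum fun i _ => mul_le_mul_of_nonneg_left (hu4 i) (hw i)
  have hm := rpow_sub_log_mono hs0 (by linarith) hv
  have h4D : 0 < 4 * D := by linarith
  have hx0 : 0 ≤ s * Real.log (4 * D) := mul_nonneg hs0 (Real.log_nonneg (by linarith))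
  have hq := exp_sub_sub_one_le hx0 hx
  have hpt : ∑ i, w i * φ i ^ s ≤ s * ∑ i, w i * Real.log (φ i)
      + ∑ i, w i * ((φ i + (φ i)⁻¹ + 2) ^ s - s * Real.log (φ i + (φ i)⁻¹ + 2)) := by
    rw [Finset.mul_sum, ← Finset.sum_add_distrib]
    refine Finset.sum_le_sum fun i _ => ?_
    calc w i * φ i ^ s ≤ w i * _ :=
          mul_le_mul_of_nonneg_left (rpow_le_linear_add (hφ i) hs0) (hw i)
      _ = _ := by ring
  have he : (4 * D) ^ s = Real.exp (s * Real.log (4 * D)) := by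
    rw [Real.rpow_def_of_pos h4D, mul_comm]
  rw [he] at hm
  have := Real.add_one_le_exp
    (s * ∑ i, w i * Real.log (φ i) + 3 / 4 * (s * Real.log (4 * D)) ^ 2)
  linarith

/-- A sub-Gaussian moment estimate for the likelihood ratio `φ`: if `E φ ≤ 1` and `E φ⁻¹ ≤ D`,
then `E φ ^ s` exceeds `exp (s E log φ)` by a factor of second order in `s log (4 D)` only. -/
theorem moment_le_exp {Ω : Type*} [Fintype Ω] {w φ : Ω → ℝ} {D s : ℝ}
    (hw : ∀ i, 0 ≤ w i) (hφ : ∀ i, w i ≠ 0 → 0 < φ i) (hsum : ∑ i, w i = 1)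
    (h₁ : ∑ i, w i * φ i ≤ 1) (h₂ : ∑ i, w i * (φ i)⁻¹ ≤ D) (hD : 1 ≤ D)
    (hs0 : 0 ≤ s) (hs1 : s ≤ 1 / 2) (hx : s * Real.log (4 * D) ≤ 1) :
    ∑ i, w i * φ i ^ s
      ≤ Real.exp (s * ∑ i, w i * Real.log (φ i) + 3 / 4 * (s * Real.log (4 * D)) ^ 2) := by
  classical
  have key : ∀ f : ℝ → ℝ, ∑ i, w i * f (if w i = 0 then 1 else φ i) = ∑ i, w i * f (φ i) := by
    intro f
    refine Finset.sum_congr rfl fun i _ => ?_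
    split_ifs with h <;> simp [h]
  have := moment_le_exp_of_pos (φ := fun i => if w i = 0 then 1 else φ i) (D := D) (s := s) hw
    (fun i => by
      split_ifs with h
      · exact one_pos
      · exact hφ i h) hsum
    (by rw [key fun x => x]; exact h₁) (by rw [key fun x => x⁻¹]; exact h₂) hD hs0 hs1 hx
  rw [key fun x => x ^ s, key Real.log] at this
  exact this

/-- Jensen's inequality for the logarithm, with weights that may vanish outside the domain. -/
theorem sum_mul_log_le {Ω : Type*} [Fintype Ω] {w φ : Ω → ℝ} {D : ℝ}
    (hw : ∀ i, 0 ≤ w i) (hφ : ∀ i, w i ≠ 0 → 0 < φ i) (hsum : ∑ i, w i = 1)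
    (h : ∑ i, w i * φ i ≤ D) : ∑ i, w i * Real.log (φ i) ≤ Real.log D := by
  have hpos : 0 < ∑ i, w i * φ i := by
    obtain ⟨i, -, hi⟩ := Finset.exists_ne_zero_of_sum_ne_zero (hsum ▸ one_ne_zero)
    refine Finset.sum_pos' (fun j _ => ?_)
      ⟨i, Finset.mem_univ _, mul_pos (lt_of_le_of_ne (hw i) (Ne.symm hi)) (hφ i hi)⟩
    by_cases hj : w j = 0
    · simp [hj]
    · exact mul_nonneg (hw j) (hφ j hj).le
  have hD := hpos.trans_le h
  have hpt : ∀ i, w i * Real.log (φ i) ≤ w i * φ i / D + w i * (Real.log D - 1) := by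
    intro i
    by_cases hi : w i = 0
    · simp [hi]
    have h1 := Real.log_le_sub_one_of_pos (div_pos (hφ i hi) hD)
    rw [Real.log_div (hφ i hi).ne' hD.ne'] at h1
    calc w i * Real.log (φ i) ≤ w i * (φ i / D + (Real.log D - 1)) :=
          mul_le_mul_of_nonneg_left (by linarith) (hw i)
      _ = _ := by ring
  calc ∑ i, w i * Real.log (φ i) ≤ ∑ i, (w i * φ i / D + w i * (Real.log D - 1)) :=
        Finset.sum_le_sum fun i _ => hpt i
    _ = (∑ i, w i * φ i) / D + (Real.log D - 1) := by
        rw [Finset.sum_add_distrib, ← Finset.sum_div, ← Finset.sum_mul, hsum, one_mul]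
    _ ≤ 1 + (Real.log D - 1) := by gcongr; exact (div_le_one hD).2 h
    _ = Real.log D := by ring

theorem binaryEntropy_eq (p : ℝ) : binaryEntropy p = Real.binEntropy p / Real.log 2 := by
  simp only [binaryEntropy, Real.binEntropy, Real.logb, Real.log_inv]
  ring

theorem binaryEntropy_le_one (p : ℝ) : binaryEntropy p ≤ 1 := by
  rw [binaryEntropy_eq, div_le_one (Real.log_pos (by norm_num))]
  exact Real.binEntropy_le_log_two

theorem two_mul_le_binaryEntropy {p : ℝ} (h0 : 0 ≤ p) (h1 : p ≤ 1 / 2) :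
    2 * p ≤ binaryEntropy p := by
  rw [binaryEntropy_eq, le_div_iff₀ (Real.log_pos (by norm_num))]
  have h := Real.strictConcave_binEntropy.concaveOn.2
    (show (0 : ℝ) ∈ Set.Icc 0 1 by norm_num) (show (2⁻¹ : ℝ) ∈ Set.Icc 0 1 by norm_num)
    (show 0 ≤ 1 - 2 * p by linarith) (show 0 ≤ 2 * p by linarith) (by ring)
  simp only [smul_eq_mul, Real.binEntropy_zero, Real.binEntropy_two_inv] at h
  have e : (1 - 2 * p) * 0 + 2 * p * 2⁻¹ = p := by ring
  rw [e] at h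
  linarith

/-- A single term of the binomial expansion of `(p + (1 - p)) ^ n` is at most one. -/
theorem choose_le_two_rpow_binaryEntropy {n r : ℕ} (hn : 0 < n) (hr : r ≤ n) :
    (n.choose r : ℝ) ≤ 2 ^ ((n : ℝ) * binaryEntropy ((r : ℝ) / n)) := by
  have hn' : (0 : ℝ) < n := by exact_mod_cast hn
  set p : ℝ := (r : ℝ) / n with hp
  have hp0 : 0 ≤ p := by positivity
  have hp1 : p ≤ 1 := (div_le_one hn').2 (by exact_mod_cast hr)
  have hpow : ∀ (x : ℝ) (k : ℕ), 0 ≤ x → (x = 0 → k = 0) →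
      x ^ k = 2 ^ ((k : ℝ) * Real.logb 2 x) := by
    intro x k hx hk
    rcases hx.eq_or_lt with h | h
    · simp [hk h.symm]
    · rw [mul_comm, Real.rpow_mul (by norm_num), Real.rpow_logb (by norm_num) (by norm_num) h,
        Real.rpow_natCast]
  have hrp : (r : ℝ) = n * p := by rw [hp]; field_simp
  have hb : p ^ r * (1 - p) ^ (n - r) * (n.choose r : ℝ) ≤ 1 := by
    have h := add_pow p (1 - p) n
    rw [add_sub_cancel, one_pow] at h
    refine le_of_le_of_eq ?_ h.symm
    exact Finset.single_le_sum
      (f := fun m => p ^ m * (1 - p) ^ (n - m) * (n.choose m : ℝ))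
      (fun i _ => mul_nonneg (mul_nonneg (pow_nonneg hp0 _) (pow_nonneg (by linarith) _))
        (Nat.cast_nonneg _)) (Finset.mem_range.2 (Nat.lt_succ_of_le hr))
  rw [hpow p r hp0 (fun h => by rw [h, mul_zero] at hrp; exact_mod_cast hrp),
    hpow (1 - p) (n - r) (by linarith) (fun h => by
      have : (r : ℝ) = n := by rw [hrp, show p = 1 by linarith, mul_one]
      have : r = n := by exact_mod_cast this
      omega), ← Real.rpow_add (by norm_num)] at hb
  have e : ((r : ℝ) * Real.logb 2 p + ((n - r : ℕ) : ℝ) * Real.logb 2 (1 - p))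
      = -((n : ℝ) * binaryEntropy p) := by
    rw [Nat.cast_sub hr, hrp, binaryEntropy]
    ring
  rw [e, Real.rpow_neg (by norm_num)] at hb
  have h2 : (0 : ℝ) < 2 ^ ((n : ℝ) * binaryEntropy p) := by positivity
  rwa [inv_mul_le_iff₀ h2, mul_one] at hb

/-! ### Frobenius norm, trace norm and positivity -/

/-- The squared Frobenius (Hilbert–Schmidt) norm `tr (A Aᴴ)`. -/
noncomputable def frobSq {m k : Type*} [Fintype m] [Fintype k] (A : Matrix m k ℂ) : ℝ :=
  ∑ i, ∑ j, ‖A i j‖ ^ 2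

section
variable {m k l : Type*} [Fintype m] [Fintype k] [Fintype l]

theorem frobSq_nonneg (A : Matrix m k ℂ) : 0 ≤ frobSq A := by
  unfold frobSq; positivity

theorem mul_conjTranspose_diag (A : Matrix m k ℂ) (i : m) :
    (A * Aᴴ) i i = ((∑ j, ‖A i j‖ ^ 2 : ℝ) : ℂ) := by
  rw [mul_apply]
  push_cast
  refine Finset.sum_congr rfl fun j _ => ?_
  rw [conjTranspose_apply]
  exact RCLike.mul_conj (A i j)

theorem trace_mul_conjTranspose (A : Matrix m k ℂ) : (A * Aᴴ).trace = (frobSq A : ℂ) := by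
  simp only [trace, diag_apply, mul_conjTranspose_diag, frobSq, Complex.ofReal_sum]

theorem frobSq_unitary_mul [DecidableEq m] {U : Matrix l m ℂ} (hU : Uᴴ * U = 1)
    (A : Matrix m k ℂ) : frobSq (U * A) = frobSq A := by
  have h : ((frobSq (U * A) : ℝ) : ℂ) = frobSq A := by
    rw [← trace_mul_conjTranspose, ← trace_mul_conjTranspose, conjTranspose_mul, trace_mul_comm,
      Matrix.mul_assoc, ← Matrix.mul_assoc Uᴴ, hU, Matrix.one_mul, trace_mul_comm]
  exact_mod_cast h

theorem frobSq_smul (c : ℝ) (A : Matrix m k ℂ) : frobSq ((c : ℂ) • A) = c ^ 2 * frobSq A := by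
  simp only [frobSq, Matrix.smul_apply, smul_eq_mul, norm_mul, mul_pow, Finset.mul_sum,
    Complex.norm_real, Real.norm_eq_abs, sq_abs]

theorem frobSq_kronecker {m' k' : Type*} [Fintype m'] [Fintype k'] (A : Matrix m k ℂ)
    (B : Matrix m' k' ℂ) : frobSq (A ⊗ₖ B) = frobSq A * frobSq B := by
  simp only [frobSq, Fintype.sum_prod_type, kroneckerMap_apply, norm_mul, mul_pow]
  rw [Finset.sum_mul_sum]
  refine Finset.sum_congr rfl fun i _ => Finset.sum_congr rfl fun i' _ => ?_
  rw [Finset.sum_mul_sum]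

theorem frobSq_submatrix {m' k' : Type*} [Fintype m'] [Fintype k'] (A : Matrix m k ℂ)
    (e : m' ≃ m) (f : k' ≃ k) : frobSq (A.submatrix e f) = frobSq A := by
  simp only [frobSq, submatrix_apply]
  rw [e.sum_comp (fun i => ∑ j, ‖A i (f j)‖ ^ 2)]
  exact Finset.sum_congr rfl fun i _ => f.sum_comp (fun j => ‖A i j‖ ^ 2)

section Norm
open scoped Matrix.Norms.Frobenius

theorem frobenius_norm_eq_sqrt (A : Matrix m k ℂ) : ‖A‖ = √(frobSq A) := by
  rw [frobenius_norm_def, Real.sqrt_eq_rpow, frobSq]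
  simp only [Real.rpow_ofNat]

theorem sqrt_frobSq_add_le (A B : Matrix m k ℂ) :
    √(frobSq (A + B)) ≤ √(frobSq A) + √(frobSq B) := by
  simpa only [frobenius_norm_eq_sqrt] using norm_add_le A B

end Norm

theorem frobSq_sum_le {τ : Type*} (s : Finset τ) (A : τ → Matrix m k ℂ) :
    frobSq (∑ x ∈ s, A x) ≤ s.card * ∑ x ∈ s, frobSq (A x) := by
  have e : ∑ x ∈ s, frobSq (A x) = ∑ i, ∑ j, ∑ x ∈ s, ‖A x i j‖ ^ 2 := by
    simp only [frobSq]
    rw [Finset.sum_comm]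
    exact Finset.sum_congr rfl fun i _ => Finset.sum_comm
  rw [e, frobSq]
  rw [Finset.mul_sum]
  refine Finset.sum_le_sum fun i _ => ?_
  rw [Finset.mul_sum]
  refine Finset.sum_le_sum fun j _ => ?_
  rw [Matrix.sum_apply]
  calc ‖∑ x ∈ s, A x i j‖ ^ 2 ≤ (∑ x ∈ s, ‖A x i j‖) ^ 2 := by
        gcongr; exact norm_sum_le _ _
    _ ≤ _ := sq_sum_le_card_mul_sum_sq

/-- Operator convexity of `B ↦ B Bᴴ`. -/
theorem posSemidef_card_smul_sum_sub {τ : Type*} (s : Finset τ) (B : τ → Matrix m k ℂ) :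
    ((s.card : ℝ) • ∑ x ∈ s, B x * (B x)ᴴ
      - (∑ x ∈ s, B x) * (∑ x ∈ s, B x)ᴴ).PosSemidef := by
  rcases s.eq_empty_or_nonempty with rfl | hs
  · simpa using PosSemidef.zero
  have hN : (0 : ℝ) < s.card := by exact_mod_cast hs.card_pos
  set S := ∑ x ∈ s, B x with hS
  set C := ((s.card : ℝ)⁻¹) • S with hC
  have hSC : S = (s.card : ℝ) • C := by rw [hC, smul_smul, mul_inv_cancel₀ hN.ne', one_smul]
  -- the difference is the variance of the family `B` around its mean `C`
  have e : (s.card : ℝ) • ∑ x ∈ s, B x * (B x)ᴴ - S * Sᴴ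
      = (s.card : ℝ) • ∑ x ∈ s, (B x - C) * (B x - C)ᴴ := by
    have h1 : ∑ x ∈ s, (B x - C) * (B x - C)ᴴ
        = ∑ x ∈ s, B x * (B x)ᴴ - S * Cᴴ - C * Sᴴ + (s.card : ℝ) • (C * Cᴴ) := by
      simp only [conjTranspose_sub, Matrix.sub_mul, Matrix.mul_sub, Finset.sum_sub_distrib,
        Finset.sum_const, hS, conjTranspose_sum, Matrix.sum_mul, Matrix.mul_sum]
      rw [← Nat.cast_smul_eq_nsmul ℝ]
      abel
    rw [h1, hSC]
    simp only [conjTranspose_smul, star_trivial, Matrix.smul_mul, Matrix.mul_smul, smul_add,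
      smul_sub]
    abel
  rw [e]
  exact PosSemidef.smul (posSemidef_sum _ fun x _ => posSemidef_self_mul_conjTranspose _) hN.le

theorem posSemidef_one_sub_conjTranspose_mul_self [DecidableEq m] [DecidableEq k]
    {N : Matrix m k ℂ} (h : (1 - N * Nᴴ).PosSemidef) : (1 - Nᴴ * N).PosSemidef := by
  have e : 1 - Nᴴ * N = (1 - Nᴴ * N)ᴴ * (1 - Nᴴ * N) + Nᴴ * (1 - N * Nᴴ) * N := by
    simp only [conjTranspose_sub, conjTranspose_one, conjTranspose_mul,
      conjTranspose_conjTranspose, Matrix.sub_mul, Matrix.mul_sub, Matrix.one_mul, Matrix.mul_one,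
      Matrix.mul_assoc]
    abel
  rw [e]
  exact (posSemidef_conjTranspose_mul_self _).add (h.conjTranspose_mul_mul_same N)

/-- The spectral theorem, together with the values of the trace of functions and of the rank. -/
theorem exists_diagonalization [DecidableEq m] {A : Matrix m m ℂ} (hA : A.IsHermitian) :
    ∃ (U : Matrix m m ℂ) (v : m → ℝ), Uᴴ * U = 1 ∧ U * Uᴴ = 1 ∧
      A = U * diagonal (fun i => (v i : ℂ)) * Uᴴ ∧
      (∀ f : ℝ → ℝ, (cfc f A).trace = ((∑ i, f (v i) : ℝ) : ℂ)) ∧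
      (A.rank = Fintype.card {i // v i ≠ 0}) ∧ (A.PosSemidef → ∀ i, 0 ≤ v i) := by
  have h1 : (hA.eigenvectorUnitary : Matrix m m ℂ)ᴴ * hA.eigenvectorUnitary = 1 :=
    Unitary.coe_star_mul_self hA.eigenvectorUnitary
  refine ⟨hA.eigenvectorUnitary, hA.eigenvalues, h1, ?_, ?_, ?_, hA.rank_eq_card_non_zero_eigs,
    fun h i => h.eigenvalues_nonneg i⟩
  · exact Unitary.coe_mul_star_self hA.eigenvectorUnitary
  · have := hA.spectral_theorem
    rwa [Unitary.conjStarAlgAut_apply] at this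
  · intro f
    rw [hA.cfc_eq, IsHermitian.cfc, Unitary.conjStarAlgAut_apply, trace_mul_comm,
      ← Matrix.mul_assoc]
    change ((hA.eigenvectorUnitary : Matrix m m ℂ)ᴴ * hA.eigenvectorUnitary * _).trace = _
    rw [h1, Matrix.one_mul, trace_diagonal]
    simp

theorem trace_unitary_conj [DecidableEq m] {U : Matrix m m ℂ} (hU : Uᴴ * U = 1)
    (A : Matrix m m ℂ) : (U * A * Uᴴ).trace = A.trace := by
  rw [trace_mul_comm, ← Matrix.mul_assoc, hU, Matrix.one_mul]

/-- In an eigenbasis of `b bᴴ - a aᴴ`, each eigenvalue is a difference of squared row norms of `b`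
and `a`; the bound follows from the Cauchy–Schwarz inequality. -/
theorem traceNorm_sub_le [DecidableEq m] (a b : Matrix m k ℂ) :
    traceNorm (b * bᴴ - a * aᴴ) ≤ √(frobSq (b - a)) * (√(frobSq b) + √(frobSq a)) := by
  have hH : (b * bᴴ - a * aᴴ).IsHermitian :=
    (isHermitian_mul_conjTranspose_self b).sub (isHermitian_mul_conjTranspose_self a)
  obtain ⟨U, v, hU, hU', hd, htr, -⟩ := exists_diagonalization hH
  have hv : ∀ i, v i = ∑ j, (‖(Uᴴ * b) i j‖ ^ 2 - ‖(Uᴴ * a) i j‖ ^ 2) := by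
    intro i
    have e : diagonal (fun i => (v i : ℂ)) = (Uᴴ * b) * (Uᴴ * b)ᴴ - (Uᴴ * a) * (Uᴴ * a)ᴴ := by
      have : Uᴴ * (b * bᴴ - a * aᴴ) * U = diagonal (fun i => (v i : ℂ)) := by
        rw [hd]
        simp only [Matrix.mul_assoc, hU, Matrix.mul_one]
        rw [← Matrix.mul_assoc, hU, Matrix.one_mul]
      rw [← this]
      simp only [conjTranspose_mul, conjTranspose_conjTranspose, Matrix.mul_sub, Matrix.sub_mul,
        Matrix.mul_assoc]
    have h := congrFun (congrFun e i) i
    rw [diagonal_apply_eq, Matrix.sub_apply, mul_conjTranspose_diag, mul_conjTranspose_diag] at h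
    rw [Finset.sum_sub_distrib]
    exact_mod_cast h
  have hUU : (Uᴴ)ᴴ * Uᴴ = 1 := by rw [conjTranspose_conjTranspose, hU']
  rw [traceNorm, htr, Complex.ofReal_re, ← frobSq_unitary_mul hUU (b - a),
    ← frobSq_unitary_mul hUU b, ← frobSq_unitary_mul hUU a, Matrix.mul_sub]
  set b' := Uᴴ * b
  set a' := Uᴴ * a
  have cs : ∀ x y : Matrix m k ℂ, ∑ i, ∑ j, ‖x i j‖ * ‖y i j‖ ≤ √(frobSq x) * √(frobSq y) := by
    intro x y
    have := Real.sum_mul_le_sqrt_mul_sqrt (Finset.univ : Finset (m × k))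
      (fun p => ‖x p.1 p.2‖) (fun p => ‖y p.1 p.2‖)
    simpa only [Fintype.sum_prod_type, frobSq] using this
  calc ∑ i, |v i| ≤ ∑ i, ∑ j, (‖(b' - a') i j‖ * ‖b' i j‖ + ‖(b' - a') i j‖ * ‖a' i j‖) := by
        refine Finset.sum_le_sum fun i _ => ?_
        rw [hv]
        refine (Finset.abs_sum_le_sum_abs _ _).trans (Finset.sum_le_sum fun j _ => ?_)
        rw [sq_sub_sq, abs_mul, ← mul_add, mul_comm,
          abs_of_nonneg (add_nonneg (norm_nonneg _) (norm_nonneg _))]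
        exact mul_le_mul_of_nonneg_right (abs_norm_sub_norm_le _ _) (by positivity)
    _ = ∑ i, ∑ j, ‖(b' - a') i j‖ * ‖b' i j‖ + ∑ i, ∑ j, ‖(b' - a') i j‖ * ‖a' i j‖ := by
        simp only [Finset.sum_add_distrib]
    _ ≤ _ := by rw [mul_add]; exact add_le_add (cs _ _) (cs _ _)

/-- A factor `b` that is close to `a` yields, after shrinking it to norm at most one, an operator
in the smoothing ball around `a aᴴ`. -/
theorem exists_mem_smoothingBall [DecidableEq m] {a b : Matrix m k ℂ} {ε : ℝ}
    (hε : 0 ≤ ε) (ha : frobSq a = 1) (hab : frobSq (b - a) ≤ (ε / 4) ^ 2) :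
    ∃ c : ℝ, 0 ≤ c ∧ c ≤ 1 ∧ c • (b * bᴴ) ∈ smoothingBall ε (a * aᴴ) := by
  set β := √(frobSq b) with hβ
  have hβ0 : 0 ≤ β := Real.sqrt_nonneg _
  set M := max 1 β with hM
  have hM1 : 1 ≤ M := le_max_left _ _
  have hMpos : 0 < M := by linarith
  have hMinv : M⁻¹ ≤ 1 := inv_le_one_of_one_le₀ hM1
  have hMinv0 : 0 < M⁻¹ := inv_pos.2 hMpos
  have hd : √(frobSq (b - a)) ≤ ε / 4 := Real.sqrt_le_iff.2 ⟨by positivity, hab⟩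
  set b' := ((M⁻¹ : ℝ) : ℂ) • b with hb'
  have hb'n : √(frobSq b') = M⁻¹ * β := by
    rw [hb', frobSq_smul, Real.sqrt_mul (sq_nonneg _), Real.sqrt_sq hMinv0.le]
  have hb'1 : √(frobSq b') ≤ 1 := by
    rw [hb'n, inv_mul_le_iff₀ hMpos, mul_one]; exact le_max_right _ _
  have hβa : β ≤ 1 + ε / 4 := by
    have h := sqrt_frobSq_add_le a (b - a)
    rw [add_sub_cancel, ha, Real.sqrt_one] at h
    linarith
  have hb'b : √(frobSq (b' - b)) ≤ ε / 4 := by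
    have e : b' - b = ((M⁻¹ - 1 : ℝ) : ℂ) • b := by
      rw [hb']; push_cast; rw [sub_smul, one_smul]
    rw [e, frobSq_smul, Real.sqrt_mul (sq_nonneg _), Real.sqrt_sq_eq_abs, abs_sub_comm,
      abs_of_nonneg (by linarith), ← hβ]
    rcases le_total β 1 with h | h
    · rw [hM, max_eq_left h]; simpa using by positivity
    · rw [hM, max_eq_right h]
      have : β⁻¹ * β = 1 := inv_mul_cancel₀ (by linarith)
      linarith [show (1 - β⁻¹) * β = β - 1 by rw [sub_mul, this, one_mul]]
  have hsm : (M⁻¹ ^ 2 : ℝ) • (b * bᴴ) = b' * b'ᴴ := by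
    rw [hb', conjTranspose_smul, Matrix.smul_mul, Matrix.mul_smul, smul_smul]
    ext i j
    simp [Matrix.smul_apply, sq]
  refine ⟨M⁻¹ ^ 2, by positivity, pow_le_one₀ hMinv0.le hMinv, ?_⟩
  rw [hsm]
  have htra : (a * aᴴ).trace.re = 1 := by rw [trace_mul_conjTranspose, ha]; simp
  refine ⟨posSemidef_self_mul_conjTranspose _, ?_, ?_⟩
  · rw [htra, one_mul]
    refine (traceNorm_sub_le a b').trans ?_
    have h1 : √(frobSq (b' - a)) ≤ ε / 2 := by
      have h := sqrt_frobSq_add_le (b' - b) (b - a)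
      rw [sub_add_sub_cancel] at h
      linarith
    rw [ha, Real.sqrt_one]
    calc √(frobSq (b' - a)) * (√(frobSq b') + 1) ≤ ε / 2 * (1 + 1) := by gcongr
      _ = ε := by ring
  · rw [htra, trace_mul_conjTranspose, Complex.ofReal_re]
    have := Real.sqrt_le_iff.1 hb'1
    simpa using this.2

end

/-! ### Smoothing an operator below a multiple of another one -/

section
variable {Z : Type*} [Fintype Z] [DecidableEq Z]

/-- The kernel `min (z i) (z j)` is the Gram matrix of the indicators of the intervals
`[0, z i]`. -/
theorem posSemidef_min {ι : Type*} [Finite ι] {z : ι → ℝ} (hz : ∀ i, 0 ≤ z i) :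
    (Matrix.of fun i j => ((min (z i) (z j) : ℝ) : ℂ)).PosSemidef := by
  have h := Matrix.posSemidef_gram ℂ fun i => MeasureTheory.indicatorConstLp
    (μ := (MeasureTheory.volume : MeasureTheory.Measure ℝ)) 2
    (measurableSet_Icc (a := (0 : ℝ)) (b := z i)) isCompact_Icc.measure_ne_top (1 : ℂ)
  refine (congrArg PosSemidef (Matrix.ext fun i j => ?_)).mpr h
  rw [Matrix.gram_apply, MeasureTheory.L2.inner_indicatorConstLp_one_indicatorConstLp_one
    measurableSet_Icc measurableSet_Icc isCompact_Icc.measure_ne_top isCompact_Icc.measure_ne_top,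
    Set.Icc_inter_Icc]
  simp [hz i, hz j]

/-- The matrix `u` with the entries damped by the factors `min (q b) (p a) / p a`. Columns with
`p a = 0` are set to zero. -/
noncomputable def softCutoff (p q : Z → ℝ) (u : Matrix Z Z ℂ) : Matrix Z Z ℂ :=
  Matrix.of fun b a => ((min (q b) (p a) / p a : ℝ) : ℂ) * u b a

/-- By the Schur product theorem, damping multiplies the block matrix of `u` with a positive
kernel; the claim is the nonnegativity of the corresponding Schur complement. -/
theorem posSemidef_diagonal_sub_softCutoff {p q : Z → ℝ} (hp : ∀ a, 0 ≤ p a) (hq : ∀ b, 0 ≤ q b)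
    {u : Matrix Z Z ℂ} (hu : u * uᴴ = 1) :
    (diagonal (fun b => (q b : ℂ))
      - softCutoff p q u * diagonal (fun a => (p a : ℂ)) * (softCutoff p q u)ᴴ).PosSemidef := by
  set Q := diagonal (fun b => (q b : ℂ)) with hQ
  set P := diagonal (fun a => (p a : ℂ)) with hP
  set N := softCutoff p q u with hN
  set C : Matrix Z Z ℂ := Matrix.of fun b a => ((min (q b) (p a) : ℝ) : ℂ) * u b a with hC
  have hCN : C = N * P := by
    ext b a
    rw [hP, mul_diagonal, hN, softCutoff, hC, of_apply, of_apply]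
    rcases (hp a).eq_or_lt with h | h
    · rw [← h, min_eq_right (hq b)]; simp
    · have : (p a : ℂ) ≠ 0 := by exact_mod_cast h.ne'
      push_cast
      field_simp
  have hK : (fromBlocks Q C Cᴴ P).PosSemidef := by
    have h1 : (fromBlocks (1 : Matrix Z Z ℂ) u uᴴ 1).PosSemidef := by
      have h := posSemidef_self_mul_conjTranspose (fromRows u (1 : Matrix Z Z ℂ))
      rw [conjTranspose_fromRows_eq_fromCols_conjTranspose, fromRows_mul_fromCols, hu] at h
      simpa using h
    have h2 := posSemidef_min (z := Sum.elim q p) (by rintro (b | a); exacts [hq b, hp a])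
    refine (congrArg PosSemidef (Matrix.ext fun i j => ?_)).mpr (h2.hadamard h1)
    rcases i with i | i <;> rcases j with j | j
    · by_cases h : i = j
      · subst h; simp [hQ]
      · simp [hQ, h]
    · simp [hC]
    · simp [hC, min_comm]
    · by_cases h : i = j
      · subst h; simp [hP]
      · simp [hP, h]
  have hPh : Pᴴ = P := by
    rw [hP, diagonal_conjTranspose]; congr 1; ext a; simp
  -- this compression is the Schur complement, also where `P` is not invertible
  have h := hK.mul_mul_conjTranspose_same (fromCols (1 : Matrix Z Z ℂ) (-N))
  convert h using 1
  rw [conjTranspose_fromCols_eq_fromRows_conjTranspose, fromCols_mul_fromBlocks,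
    fromCols_mul_fromRows, hCN]
  simp only [Matrix.one_mul, conjTranspose_one, Matrix.mul_one, conjTranspose_mul, hPh,
    conjTranspose_neg, Matrix.mul_neg, Matrix.neg_mul, Matrix.add_mul, Matrix.mul_assoc]
  abel

/-- The damping factor differs from `1` only where the likelihood ratio `p / q` exceeds `1`. -/
theorem norm_one_sub_softCutoff_sq_le {p q w s : ℝ} (hp : 0 ≤ p) (hq : 0 ≤ q)
    (hs : 0 ≤ s) (hw0 : 0 ≤ w) (hw : q = 0 → p * w = 0) :
    (1 - min q p / p) ^ 2 * (p * w) ≤ p * w * (p / q) ^ s := by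
  rcases hp.eq_or_lt with h | h
  · simp [← h]
  rcases hq.eq_or_lt with h' | h'
  · rw [hw h'.symm]; simp
  rcases le_total p q with hpq | hpq
  · rw [min_eq_right hpq, div_self h.ne']
    rw [sub_self, zero_pow two_ne_zero, zero_mul]
    positivity
  · rw [min_eq_left hpq, mul_comm]
    gcongr
    have h1 : (1 - q / p) ^ 2 ≤ 1 := by
      have h2 : q / p ≤ 1 := (div_le_one h).2 hpq
      have h3 : 0 ≤ q / p := by positivity
      exact pow_le_one₀ (by linarith) (by linarith)
    exact h1.trans (Real.one_le_rpow ((one_le_div h').2 hpq) hs)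

/-- For operators `S` and `G` with spectral decompositions `(U, p)` and `(V, q)`, there is an
operator `M` with `M S Mᴴ ≤ G` that moves every factor of `S` by at most the `s`-th moment of the
likelihood ratio `p a / q b` under the weights `p a * |⟨v_b, u_a⟩| ^ 2`. -/
theorem exists_smoothing {U V : Matrix Z Z ℂ} {p q : Z → ℝ} (hU : Uᴴ * U = 1) (hU' : U * Uᴴ = 1)
    (hV : Vᴴ * V = 1) (hV' : V * Vᴴ = 1)
    (hp : ∀ a, 0 ≤ p a) (hq : ∀ b, 0 ≤ q b)
    (hsupp : ∀ a b, q b = 0 → p a * ‖(Vᴴ * U) b a‖ ^ 2 = 0) {s : ℝ} (hs : 0 ≤ s)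
    {S G : Matrix Z Z ℂ} (hS : S = U * diagonal (fun a => (p a : ℂ)) * Uᴴ)
    (hG : G = V * diagonal (fun b => (q b : ℂ)) * Vᴴ) :
    ∃ M : Matrix Z Z ℂ, (G - M * S * Mᴴ).PosSemidef ∧
      ∀ {k : Type _} [Fintype k] (A : Matrix Z k ℂ), A * Aᴴ = S →
        frobSq (M * A - A) ≤
          ∑ a, ∑ b, p a * ‖(Vᴴ * U) b a‖ ^ 2 * (p a / q b) ^ s := by
  set u := Vᴴ * U with hu
  have huu : u * uᴴ = 1 := by
    rw [hu, conjTranspose_mul, conjTranspose_conjTranspose, Matrix.mul_assoc,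
      ← Matrix.mul_assoc U, hU', Matrix.one_mul, hV]
  set N := softCutoff p q u with hN
  set P := diagonal (fun a => (p a : ℂ)) with hP
  refine ⟨V * N * Uᴴ, ?_, ?_⟩
  · have h := (posSemidef_diagonal_sub_softCutoff hp hq huu).mul_mul_conjTranspose_same V
    convert h using 1
    rw [hS, hG, Matrix.mul_sub, Matrix.sub_mul]
    congr 1
    simp only [conjTranspose_mul, conjTranspose_conjTranspose, Matrix.mul_assoc]
    congr 2
    rw [← Matrix.mul_assoc Uᴴ U, hU, Matrix.one_mul, ← Matrix.mul_assoc Uᴴ U, hU, Matrix.one_mul]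
  · intro k _ A hA
    have e1 : V * N * Uᴴ * A - A = V * ((N - u) * (Uᴴ * A)) := by
      rw [Matrix.sub_mul, Matrix.mul_sub, hu]
      simp only [Matrix.mul_assoc]
      congr 1
      rw [← Matrix.mul_assoc U, hU', Matrix.one_mul, ← Matrix.mul_assoc V, hV', Matrix.one_mul]
    rw [e1, frobSq_unitary_mul hV]
    have e2 : (Uᴴ * A) * (Uᴴ * A)ᴴ = P := by
      rw [conjTranspose_mul, conjTranspose_conjTranspose, Matrix.mul_assoc, ← Matrix.mul_assoc A,
        hA, hS]
      simp only [Matrix.mul_assoc, hU, Matrix.mul_one]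
      rw [← Matrix.mul_assoc, hU, Matrix.one_mul]
    have e3 : ((N - u) * (Uᴴ * A)) * ((N - u) * (Uᴴ * A))ᴴ = (N - u) * P * (N - u)ᴴ := by
      rw [conjTranspose_mul (N - u), Matrix.mul_assoc, ← Matrix.mul_assoc (Uᴴ * A), e2,
        Matrix.mul_assoc]
    have e4 : frobSq ((N - u) * (Uᴴ * A))
        = ∑ b, ∑ a, (1 - min (q b) (p a) / p a) ^ 2 * (p a * ‖u b a‖ ^ 2) := by
      have h : ((frobSq ((N - u) * (Uᴴ * A)) : ℝ) : ℂ)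
          = ((∑ b, ∑ a, (1 - min (q b) (p a) / p a) ^ 2 * (p a * ‖u b a‖ ^ 2) : ℝ) : ℂ) := by
        rw [← trace_mul_conjTranspose, e3]
        push_cast
        rw [trace]
        refine Finset.sum_congr rfl fun b _ => ?_
        rw [diag_apply, mul_apply]
        refine Finset.sum_congr rfl fun a _ => ?_
        have hz : u b a * (starRingEnd ℂ) (u b a) = (‖u b a‖ : ℂ) ^ 2 := RCLike.mul_conj (u b a)
        rw [hP, mul_diagonal, conjTranspose_apply, Matrix.sub_apply, hN, softCutoff, of_apply,
          ← hz, Complex.star_def, map_sub, map_mul, Complex.conj_ofReal]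
        push_cast
        ring
      exact_mod_cast h
    rw [e4, Finset.sum_comm]
    exact Finset.sum_le_sum fun a _ => Finset.sum_le_sum fun b _ =>
      norm_one_sub_softCutoff_sq_le (hp a) (hq b) hs (by positivity) (hsupp a b)

end

/-! ### Tensor powers -/

section
variable {ι m k l : Type*} [Fintype ι] [DecidableEq ι] [Fintype m] [Fintype k] [Fintype l]

/-- The tensor power `A^{⊗ι}` of a matrix. -/
def tensorPow (ι : Type*) [Fintype ι] (A : Matrix m k ℂ) : Matrix (ι → m) (ι → k) ℂ :=
  Matrix.of fun x y => ∏ i, A (x i) (y i)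

theorem tensorPow_mul (A : Matrix m k ℂ) (B : Matrix k l ℂ) :
    tensorPow ι (A * B) = tensorPow ι A * tensorPow ι B := by
  ext x y
  simp only [tensorPow, of_apply, mul_apply, Fintype.prod_sum, Finset.prod_mul_distrib]

theorem tensorPow_conjTranspose (A : Matrix m k ℂ) : tensorPow ι Aᴴ = (tensorPow ι A)ᴴ := by
  ext x y
  simp only [tensorPow, of_apply, conjTranspose_apply, star_prod]

theorem tensorPow_diagonal [DecidableEq m] (d : m → ℂ) :
    tensorPow ι (diagonal d) = diagonal fun x => ∏ i, d (x i) := by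
  ext x y
  simp only [tensorPow, of_apply]
  by_cases h : x = y
  · subst h; simp
  · obtain ⟨i, hi⟩ := Function.ne_iff.1 h
    rw [diagonal_apply_ne _ h]
    exact Finset.prod_eq_zero (Finset.mem_univ i) (diagonal_apply_ne _ hi)

theorem tensorPow_one [DecidableEq m] : tensorPow ι (1 : Matrix m m ℂ) = 1 := by
  rw [← diagonal_one, tensorPow_diagonal]; simp

theorem sum_sum_prod_eq_pow (f : m → k → ℝ) :
    ∑ a : ι → m, ∑ b : ι → k, ∏ i, f (a i) (b i) = (∑ a, ∑ b, f a b) ^ Fintype.card ι := by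
  rw [← Finset.card_univ, ← Finset.prod_const, Fintype.prod_sum]
  exact Finset.sum_congr rfl fun a _ => (Fintype.prod_sum fun i b => f (a i) b).symm

/-- The smoothing of a tensor power: the moment of the likelihood ratio is multiplicative. -/
theorem exists_smoothing_tensorPow [DecidableEq m] {U V : Matrix m m ℂ} {p q : m → ℝ}
    (hU : Uᴴ * U = 1) (hU' : U * Uᴴ = 1) (hV : Vᴴ * V = 1) (hV' : V * Vᴴ = 1)
    (hp : ∀ a, 0 ≤ p a) (hq : ∀ b, 0 ≤ q b)
    (hsupp : ∀ a b, q b = 0 → p a * ‖(Vᴴ * U) b a‖ ^ 2 = 0) {s : ℝ} (hs : 0 ≤ s)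
    {S G : Matrix m m ℂ} (hS : S = U * diagonal (fun a => (p a : ℂ)) * Uᴴ)
    (hG : G = V * diagonal (fun b => (q b : ℂ)) * Vᴴ) {t : ℝ} (ht : 0 < t) :
    ∃ M : Matrix (ι → m) (ι → m) ℂ,
      (t • tensorPow ι G - M * tensorPow ι S * Mᴴ).PosSemidef ∧
      ∀ {κ : Type _} [Fintype κ] (A : Matrix (ι → m) κ ℂ), A * Aᴴ = tensorPow ι S →
        frobSq (M * A - A) ≤
          t ^ (-s) * (∑ a, ∑ b, p a * ‖(Vᴴ * U) b a‖ ^ 2 * (p a / q b) ^ s) ^ Fintype.card ι := by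
  have hpow : ∀ {W : Matrix m m ℂ}, Wᴴ * W = 1 → (tensorPow ι W)ᴴ * tensorPow ι W = 1 := by
    intro W hW
    rw [← tensorPow_conjTranspose, ← tensorPow_mul, hW, tensorPow_one]
  have hpow' : ∀ {W : Matrix m m ℂ}, W * Wᴴ = 1 → tensorPow ι W * (tensorPow ι W)ᴴ = 1 := by
    intro W hW
    rw [← tensorPow_conjTranspose, ← tensorPow_mul, hW, tensorPow_one]
  have hu : ∀ a b : ι → m, ‖((tensorPow ι V)ᴴ * tensorPow ι U) b a‖ ^ 2
      = ∏ i, ‖(Vᴴ * U) (b i) (a i)‖ ^ 2 := by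
    intro a b
    rw [← tensorPow_conjTranspose, ← tensorPow_mul, tensorPow, of_apply, norm_prod,
      Finset.prod_pow]
  have hqq : ∀ b : ι → m, 0 ≤ ∏ i, q (b i) := fun b => Finset.prod_nonneg fun i _ => hq _
  obtain ⟨M, hM, hMA⟩ := exists_smoothing (hpow hU) (hpow' hU') (hpow hV) (hpow' hV')
    (p := fun a => ∏ i, p (a i)) (q := fun b => t * ∏ i, q (b i))
    (fun a => Finset.prod_nonneg fun i _ => hp _) (fun b => mul_nonneg ht.le (hqq b))
    (fun a b h => by
      rcases mul_eq_zero.1 h with h | h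
      · exact absurd h ht.ne'
      obtain ⟨i, -, hi⟩ := Finset.prod_eq_zero_iff.1 h
      rw [hu, ← Finset.prod_mul_distrib]
      exact Finset.prod_eq_zero (Finset.mem_univ i) (hsupp _ _ hi)) hs
    (S := tensorPow ι S) (G := t • tensorPow ι G)
    (by
      rw [hS, tensorPow_mul, tensorPow_mul, tensorPow_diagonal, tensorPow_conjTranspose]
      push_cast
      rfl)
    (by
      have e : (diagonal fun b : ι → m => ((t * ∏ i, q (b i) : ℝ) : ℂ))
          = t • diagonal fun b : ι → m => ∏ i, (q (b i) : ℂ) := by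
        rw [← diagonal_smul]
        congr 1
        ext b
        simp
      rw [e, hG, tensorPow_mul, tensorPow_mul, tensorPow_diagonal, tensorPow_conjTranspose,
        Matrix.mul_smul, Matrix.smul_mul])
  refine ⟨M, hM, fun A hA => (hMA A hA).trans_eq ?_⟩
  rw [← sum_sum_prod_eq_pow, Finset.mul_sum]
  refine Finset.sum_congr rfl fun a _ => ?_
  rw [Finset.mul_sum]
  refine Finset.sum_congr rfl fun b _ => ?_
  rw [hu, ← Finset.prod_mul_distrib,
    Finset.prod_mul_distrib (g := fun i => (p (a i) / q (b i)) ^ s),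
    Real.finsetProd_rpow _ _ (fun i _ => div_nonneg (hp _) (hq _)), Finset.prod_div_distrib,
    mul_comm t, ← div_div, Real.div_rpow (div_nonneg (Finset.prod_nonneg fun i _ => hp _) (hqq b))
      ht.le, Real.rpow_neg ht.le]
  ring

end

/-! ### The likelihood ratio of a state and its marginal -/

section
variable {m k : Type*} [Fintype m] [Fintype k]

theorem mul_diagonal_mul_conjTranspose_diag [DecidableEq k] (C : Matrix m k ℂ) (d : k → ℝ)
    (i : m) : (C * diagonal (fun j => (d j : ℂ)) * Cᴴ) i i
      = ((∑ j, d j * ‖C i j‖ ^ 2 : ℝ) : ℂ) := by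
  rw [mul_apply]
  push_cast
  refine Finset.sum_congr rfl fun j _ => ?_
  have hz : C i j * (starRingEnd ℂ) (C i j) = (‖C i j‖ : ℂ) ^ 2 := RCLike.mul_conj (C i j)
  rw [mul_diagonal, conjTranspose_apply, ← hz, Complex.star_def]
  ring

variable [DecidableEq m]

/-- If `S ≤ G`, the mean of the likelihood ratio is `tr (S G⁻¹ S) ≤ tr S`. -/
theorem sum_ratio_le {p q : m → ℝ} {u : Matrix m m ℂ} (hp : ∀ a, 0 ≤ p a) (hq : ∀ b, 0 ≤ q b)
    (h : (diagonal (fun b => (q b : ℂ))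
      - u * diagonal (fun a => (p a : ℂ)) * uᴴ).PosSemidef) :
    ∑ a, ∑ b, p a * ‖u b a‖ ^ 2 * (p a / q b) ≤ ∑ a, p a := by
  -- `N = G^(-1/2) S^(1/2)` is a contraction; `R` vanishes on the kernel of `G`, as `0⁻¹ = 0`
  set R := diagonal (fun b => (((√(q b))⁻¹ : ℝ) : ℂ)) with hR
  set T := diagonal (fun a => ((√(p a) : ℝ) : ℂ)) with hT
  set N := R * u * T with hN
  have hRh : Rᴴ = R := by rw [hR, diagonal_conjTranspose]; congr 1; ext a; simp
  have hTh : Tᴴ = T := by rw [hT, diagonal_conjTranspose]; congr 1; ext a; simp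
  have hTT : T * T = diagonal (fun a => (p a : ℂ)) := by
    rw [hT, diagonal_mul_diagonal]
    congr 1
    ext a
    rw [← Complex.ofReal_mul, Real.mul_self_sqrt (hp a)]
  have h1 : (1 - N * Nᴴ).PosSemidef := by
    have e : 1 - N * Nᴴ = (1 - R * diagonal (fun b => (q b : ℂ)) * R)
        + R * (diagonal (fun b => (q b : ℂ)) - u * diagonal (fun a => (p a : ℂ)) * uᴴ) * Rᴴ := by
      rw [← hTT, hN]
      simp only [conjTranspose_mul, hRh, hTh, Matrix.mul_sub, Matrix.sub_mul, Matrix.mul_assoc]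
      abel
    rw [e]
    refine PosSemidef.add ?_ (h.mul_mul_conjTranspose_same R)
    rw [hR, diagonal_mul_diagonal, diagonal_mul_diagonal, ← diagonal_one, diagonal_sub]
    refine PosSemidef.diagonal fun b => ?_
    have : (√(q b))⁻¹ * q b * (√(q b))⁻¹ ≤ 1 := by
      rcases (hq b).eq_or_lt with hb | hb
      · simp [← hb]
      · have h2 : √(q b) ≠ 0 := (Real.sqrt_pos.2 hb).ne'
        rw [mul_assoc, mul_comm (q b), ← mul_assoc, ← mul_inv, Real.mul_self_sqrt hb.le,
          inv_mul_cancel₀ hb.ne']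
    rw [Pi.zero_apply, ← Complex.ofReal_one, ← Complex.ofReal_mul, ← Complex.ofReal_mul,
      ← Complex.ofReal_sub]
    exact Complex.zero_le_real.2 (sub_nonneg.2 this)
  have h2 := posSemidef_one_sub_conjTranspose_mul_self h1
  refine Finset.sum_le_sum fun a _ => ?_
  have h3 := h2.diag_nonneg (i := a)
  have e3 := mul_conjTranspose_diag Nᴴ a
  rw [conjTranspose_conjTranspose] at e3
  rw [Matrix.sub_apply, one_apply_eq, e3, ← Complex.ofReal_one, ← Complex.ofReal_sub] at h3
  have h4 : ∑ b, ‖Nᴴ a b‖ ^ 2 ≤ 1 := by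
    have : (0 : ℝ) ≤ 1 - ∑ b, ‖Nᴴ a b‖ ^ 2 := by exact_mod_cast h3
    linarith
  calc ∑ b, p a * ‖u b a‖ ^ 2 * (p a / q b) = p a * ∑ b, ‖Nᴴ a b‖ ^ 2 := by
        rw [Finset.mul_sum]
        refine Finset.sum_congr rfl fun b _ => ?_
        rw [conjTranspose_apply, norm_star, hN, hT, hR, mul_diagonal, diagonal_mul, norm_mul,
          norm_mul, Complex.norm_real, Complex.norm_real, Real.norm_of_nonneg (Real.sqrt_nonneg _),
          Real.norm_of_nonneg (inv_nonneg.2 (Real.sqrt_nonneg _)), mul_pow, mul_pow, inv_pow,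
          Real.sq_sqrt (hp a), Real.sq_sqrt (hq b)]
        ring
    _ ≤ p a * 1 := mul_le_mul_of_nonneg_left h4 (hp a)
    _ = p a := mul_one _

end

section
variable {X B : Type*} [Fintype X] [DecidableEq X] [Fintype B] [DecidableEq B]

theorem trace_traceSnd (S : Matrix (X × B) (X × B) ℂ) : (traceSnd S).trace = S.trace := by
  simp only [traceSnd, trace, diag_apply, of_apply, Fintype.sum_prod_type]

theorem trace_traceFst (S : Matrix (X × B) (X × B) ℂ) : (traceFst S).trace = S.trace := by
  simp only [traceFst, trace, diag_apply, of_apply, Fintype.sum_prod_type]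
  exact Finset.sum_comm

theorem trace_kronecker_one_mul (P : Matrix X X ℂ) (S : Matrix (X × B) (X × B) ℂ) :
    ((P ⊗ₖ (1 : Matrix B B ℂ)) * S).trace = (P * traceSnd S).trace := by
  simp only [traceSnd, trace, diag_apply, of_apply, Fintype.sum_prod_type, mul_apply,
    kroneckerMap_apply, one_apply, mul_ite, mul_one, mul_zero, ite_mul, zero_mul,
    Finset.sum_ite_eq, Finset.mem_univ, if_true, Finset.mul_sum]
  refine Finset.sum_congr rfl fun x _ => ?_
  rw [Finset.sum_comm]

/-- The mean of the inverse likelihood ratio over the support of `S`, with respect to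
`G = 1 ⊗ σ`, is at most the rank of the marginal of `S` on the first system. -/
theorem sum_support_le_rank {S : Matrix (X × B) (X × B) ℂ} {σ : Matrix B B ℂ} (hS : S.PosSemidef)
    (hσ : σ.PosSemidef) (hσ1 : σ.trace = 1) {U : Matrix (X × B) (X × B) ℂ} {p : X × B → ℝ}
    (hU' : U * Uᴴ = 1) (hp : ∀ a, 0 ≤ p a)
    (hd : S = U * diagonal (fun a => (p a : ℂ)) * Uᴴ) :
    ∑ a, (if p a = 0 then 0 else ((Uᴴ * ((1 : Matrix X X ℂ) ⊗ₖ σ) * U) a a).re)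
      ≤ (traceSnd S).rank := by
  have hherm : (traceSnd S).IsHermitian := by
    ext i j
    simp only [traceSnd, conjTranspose_apply, of_apply, star_sum]
    exact Finset.sum_congr rfl fun k _ => hS.isHermitian.apply _ _
  obtain ⟨W, v, hW, -, hv, -, hrank, -⟩ := exists_diagonalization hherm
  -- the projector onto the range of the marginal
  set P := W * diagonal (fun x => if v x = 0 then (0 : ℂ) else 1) * Wᴴ with hP
  have hPh : Pᴴ = P := by
    rw [hP, conjTranspose_mul, conjTranspose_mul, conjTranspose_conjTranspose,
      diagonal_conjTranspose, Matrix.mul_assoc]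
    congr 3
    ext x
    simp only [Pi.star_apply]
    split_ifs <;> simp
  have hmul : ∀ d e : X → ℂ, W * diagonal d * Wᴴ * (W * diagonal e * Wᴴ)
      = W * diagonal (fun x => d x * e x) * Wᴴ := by
    intro d e
    rw [← diagonal_mul_diagonal]
    simp only [Matrix.mul_assoc]
    rw [← Matrix.mul_assoc Wᴴ W, hW, Matrix.one_mul]
  have hPP : P * P = P := by
    rw [hP, hmul]
    congr 3
    ext x
    split_ifs <;> simp
  have hPS : P * traceSnd S = traceSnd S := by
    conv_lhs => rw [hv]
    conv_rhs => rw [hv]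
    rw [hP, hmul]
    congr 3
    ext x
    split_ifs with h <;> simp [h]
  have hPtr : P.trace = ((traceSnd S).rank : ℂ) := by
    rw [hP, trace_unitary_conj hW, trace_diagonal, hrank, Fintype.card_subtype]
    simp only [Finset.sum_ite, Finset.sum_const_zero, zero_add, Finset.sum_const, nsmul_eq_mul,
      mul_one]
  set R := P ⊗ₖ (1 : Matrix B B ℂ) with hR
  have hRh : Rᴴ = R := by rw [hR, conjTranspose_kronecker, hPh, conjTranspose_one]
  have hRR : R * R = R := by rw [hR, ← mul_kronecker_mul, hPP, Matrix.one_mul]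
  -- the eigenvectors of `S` with nonzero eigenvalue lie in the range of `R`
  have hcol : ∀ a, p a ≠ 0 → ∀ y, ((1 - R) * U) y a = 0 := by
    have htr : (((1 - R) * U) * diagonal (fun a => (p a : ℂ)) * ((1 - R) * U)ᴴ).trace = 0 := by
      have e : ((1 - R) * U) * diagonal (fun a => (p a : ℂ)) * ((1 - R) * U)ᴴ
          = (1 - R) * S * (1 - R) := by
        rw [hd, conjTranspose_mul, conjTranspose_sub, conjTranspose_one, hRh]
        simp only [Matrix.mul_assoc]
      have e2 : (1 - R) * (1 - R) = 1 - R := by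
        rw [Matrix.sub_mul, Matrix.one_mul, Matrix.mul_sub, Matrix.mul_one, hRR, sub_self,
          sub_zero]
      rw [e, trace_mul_comm, ← Matrix.mul_assoc, e2, Matrix.sub_mul, Matrix.one_mul, trace_sub,
        hR, trace_kronecker_one_mul, hPS, trace_traceSnd, sub_self]
    rw [trace] at htr
    simp only [diag_apply, mul_diagonal_mul_conjTranspose_diag, ← Complex.ofReal_sum] at htr
    have h0 : ∑ i, ∑ j, p j * ‖((1 - R) * U) i j‖ ^ 2 = 0 := by exact_mod_cast htr
    have hnn : ∀ i j, 0 ≤ p j * ‖((1 - R) * U) i j‖ ^ 2 := fun i j =>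
      mul_nonneg (hp j) (by positivity)
    intro a ha y
    have h1 := (Finset.sum_eq_zero_iff_of_nonneg
      (fun i _ => Finset.sum_nonneg fun j _ => hnn i j)).1 h0 y (Finset.mem_univ _)
    have h2 := (Finset.sum_eq_zero_iff_of_nonneg (fun j _ => hnn y j)).1 h1 a (Finset.mem_univ _)
    simpa [ha] using h2
  have hRU : ∀ a, p a ≠ 0 → ∀ y, (R * U) y a = U y a := by
    intro a ha y
    have := hcol a ha y
    rw [Matrix.sub_mul, Matrix.one_mul, Matrix.sub_apply, sub_eq_zero] at this
    exact this.symm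
  set G := (1 : Matrix X X ℂ) ⊗ₖ σ with hG
  have hGpos : G.PosSemidef := PosSemidef.one.kronecker hσ
  have hRG : ((R * U)ᴴ * G * (R * U)).PosSemidef := hGpos.conjTranspose_mul_mul_same _
  have htot : ((R * U)ᴴ * G * (R * U)).trace = ((traceSnd S).rank : ℂ) := by
    have e : (R * U)ᴴ * G * (R * U) = Uᴴ * (R * G * R) * U := by
      rw [conjTranspose_mul, hRh]
      simp only [Matrix.mul_assoc]
    rw [e, trace_mul_comm, ← Matrix.mul_assoc, hU', Matrix.one_mul, trace_mul_comm,
      ← Matrix.mul_assoc, hRR, hR, hG, ← mul_kronecker_mul, Matrix.mul_one, Matrix.one_mul,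
      trace_kronecker, hPtr, hσ1, mul_one]
  have htotre : ∑ a, (((R * U)ᴴ * G * (R * U)) a a).re = ((traceSnd S).rank : ℝ) := by
    have := congrArg Complex.re htot
    rw [trace, Complex.re_sum] at this
    simpa using this
  rw [← htotre]
  refine Finset.sum_le_sum fun a _ => ?_
  split_ifs with ha
  · exact (Complex.le_def.1 (hRG.diag_nonneg (i := a))).1
  · refine le_of_eq ?_
    have e : ∀ T : Matrix (X × B) (X × B) ℂ, (Tᴴ * G * T) a a
        = ∑ y, ∑ z, star (T z a) * G z y * T y a := by
      intro T
      simp only [mul_apply, conjTranspose_apply, Finset.sum_mul]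
    rw [e, e]
    simp only [hRU a ha]

/-- Spectral decompositions of a state `S ≤ 1 ⊗ S_B` and of `1 ⊗ S_B`, together with what is needed
about the likelihood ratio `p a / q b` under the weights `p a * |⟨v_b, u_a⟩| ^ 2`: its mean, the
mean of its inverse, and the mean of its logarithm, which is minus the conditional entropy. -/
theorem exists_likelihood_ratio {S : Matrix (X × B) (X × B) ℂ} (hS : S.PosSemidef)
    (hS1 : S.trace = 1) (hle : ((1 : Matrix X X ℂ) ⊗ₖ traceFst S - S).PosSemidef)
    (hσ : (traceFst S).PosSemidef) :
    ∃ (U V : Matrix (X × B) (X × B) ℂ) (p q : X × B → ℝ),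
      Uᴴ * U = 1 ∧ U * Uᴴ = 1 ∧ Vᴴ * V = 1 ∧ V * Vᴴ = 1 ∧ (∀ a, 0 ≤ p a) ∧ (∀ b, 0 ≤ q b) ∧
      (∀ a b, q b = 0 → p a * ‖(Vᴴ * U) b a‖ ^ 2 = 0) ∧
      S = U * diagonal (fun a => (p a : ℂ)) * Uᴴ ∧
      (1 : Matrix X X ℂ) ⊗ₖ traceFst S = V * diagonal (fun b => (q b : ℂ)) * Vᴴ ∧
      ∑ a, ∑ b, p a * ‖(Vᴴ * U) b a‖ ^ 2 = 1 ∧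
      ∑ a, ∑ b, p a * ‖(Vᴴ * U) b a‖ ^ 2 * (p a / q b) ≤ 1 ∧
      ∑ a, ∑ b, p a * ‖(Vᴴ * U) b a‖ ^ 2 * (p a / q b)⁻¹ ≤ (traceSnd S).rank ∧
      ∑ a, ∑ b, p a * ‖(Vᴴ * U) b a‖ ^ 2 * Real.log (p a / q b)
        = -(Real.log 2 * (vonNeumannEntropy S - vonNeumannEntropy (traceFst S))) := by
  obtain ⟨U, p, hU, hU', hUS, hcfcS, -, hpS⟩ := exists_diagonalization hS.isHermitian
  obtain ⟨W, r, hW, hW', hWσ, hcfcσ, -, hrσ⟩ := exists_diagonalization hσ.isHermitian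
  have hp := hpS hS
  have hr := hrσ hσ
  set V : Matrix (X × B) (X × B) ℂ := (1 : Matrix X X ℂ) ⊗ₖ W with hVdef
  have hV : Vᴴ * V = 1 := by
    rw [hVdef, conjTranspose_kronecker, ← mul_kronecker_mul, hW, conjTranspose_one,
      Matrix.one_mul, one_kronecker_one]
  have hV' : V * Vᴴ = 1 := by
    rw [hVdef, conjTranspose_kronecker, ← mul_kronecker_mul, hW', conjTranspose_one,
      Matrix.one_mul, one_kronecker_one]
  set q : X × B → ℝ := fun b => r b.2 with hqdef
  have hq : ∀ b, 0 ≤ q b := fun b => hr b.2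
  have hG : (1 : Matrix X X ℂ) ⊗ₖ traceFst S = V * diagonal (fun b => (q b : ℂ)) * Vᴴ := by
    have e : diagonal (fun b : X × B => (q b : ℂ))
        = (1 : Matrix X X ℂ) ⊗ₖ diagonal (fun j => (r j : ℂ)) := by
      rw [← diagonal_one, diagonal_kronecker_diagonal]
      simp [hqdef]
    rw [e, hVdef, conjTranspose_kronecker, ← mul_kronecker_mul, ← mul_kronecker_mul,
      conjTranspose_one, Matrix.one_mul, Matrix.one_mul, ← hWσ]
  set u := Vᴴ * U with hu
  have hvsv : Vᴴ * S * V = u * diagonal (fun a => (p a : ℂ)) * uᴴ := by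
    conv_lhs => rw [hUS]
    rw [hu, conjTranspose_mul, conjTranspose_conjTranspose]
    simp only [Matrix.mul_assoc]
  have hQle : (diagonal (fun b => (q b : ℂ))
      - u * diagonal (fun a => (p a : ℂ)) * uᴴ).PosSemidef := by
    have h := hle.conjTranspose_mul_mul_same V
    have e : Vᴴ * ((1 : Matrix X X ℂ) ⊗ₖ traceFst S - S) * V
        = diagonal (fun b => (q b : ℂ)) - u * diagonal (fun a => (p a : ℂ)) * uᴴ := by
      rw [Matrix.mul_sub, Matrix.sub_mul, hvsv, hG]
      congr 1
      simp only [Matrix.mul_assoc]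
      rw [hV, Matrix.mul_one, ← Matrix.mul_assoc, hV, Matrix.one_mul]
    rwa [e] at h
  -- the marginals of the weights
  have hrow : ∀ a, ∑ b, ‖u b a‖ ^ 2 = 1 := by
    intro a
    have h1 : uᴴ * u = 1 := by
      rw [hu, conjTranspose_mul, conjTranspose_conjTranspose, Matrix.mul_assoc,
        ← Matrix.mul_assoc V, hV', Matrix.one_mul, hU]
    have h := mul_conjTranspose_diag uᴴ a
    rw [conjTranspose_conjTranspose, h1, one_apply_eq] at h
    simp only [conjTranspose_apply, norm_star] at h
    exact_mod_cast h.symm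
  have hcol : ∀ j, ∑ x, ∑ a, p a * ‖u (x, j) a‖ ^ 2 = r j := by
    intro j
    have h1 : ∀ x, (Vᴴ * S * V) (x, j) (x, j) = ((∑ a, p a * ‖u (x, j) a‖ ^ 2 : ℝ) : ℂ) := by
      intro x
      rw [hvsv, mul_diagonal_mul_conjTranspose_diag]
    have h2 : ∑ x, (Vᴴ * S * V) (x, j) (x, j) = (Wᴴ * traceFst S * W) j j := by
      rw [hVdef, conjTranspose_kronecker, conjTranspose_one]
      simp only [mul_apply, Fintype.sum_prod_type, kroneckerMap_apply, one_apply, ite_mul, one_mul,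
        zero_mul, mul_ite, mul_zero, Finset.sum_ite_irrel, Finset.sum_const_zero,
        Finset.sum_ite_eq, Finset.sum_ite_eq', Finset.mem_univ, if_true, traceFst, of_apply,
        Finset.mul_sum, Finset.sum_mul]
      rw [Finset.sum_comm]
      refine Finset.sum_congr rfl fun y _ => ?_
      rw [Finset.sum_comm]
    have h3 : Wᴴ * traceFst S * W = diagonal (fun j => (r j : ℂ)) := by
      conv_lhs => rw [hWσ]
      simp only [Matrix.mul_assoc]
      rw [hW, Matrix.mul_one, ← Matrix.mul_assoc, hW, Matrix.one_mul]
    rw [h3, diagonal_apply_eq] at h2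
    simp only [h1, ← Complex.ofReal_sum] at h2
    exact_mod_cast h2
  have hsupp : ∀ a b, q b = 0 → p a * ‖u b a‖ ^ 2 = 0 := by
    intro a b hb
    have h1 := hcol b.2
    rw [show r b.2 = 0 from hb] at h1
    have hnn : ∀ x a, 0 ≤ p a * ‖u (x, b.2) a‖ ^ 2 := fun x a => mul_nonneg (hp a) (by positivity)
    have h2 := (Finset.sum_eq_zero_iff_of_nonneg
      (fun i _ => Finset.sum_nonneg fun j _ => hnn i j)).1 h1 b.1 (Finset.mem_univ _)
    exact (Finset.sum_eq_zero_iff_of_nonneg (fun j _ => hnn b.1 j)).1 h2 a (Finset.mem_univ _)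
  have hpsum : ∑ a, p a = 1 := by
    have h := hS1
    rw [hUS, trace_unitary_conj hU, trace_diagonal] at h
    exact_mod_cast h
  refine ⟨U, V, p, q, hU, hU', hV, hV', hp, hq, hsupp, hUS, hG, ?_, ?_, ?_, ?_⟩ <;>
    simp only [← hu]
  · simp only [← Finset.mul_sum, hrow, mul_one, hpsum]
  · exact (sum_ratio_le hp hq hQle).trans_eq hpsum
  · refine le_trans (le_of_eq (Finset.sum_congr rfl fun a _ => ?_))
      (sum_support_le_rank hS hσ ((trace_traceFst S).trans hS1) hU' hp hUS)
    split_ifs with ha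
    · simp [ha]
    · have e : Uᴴ * ((1 : Matrix X X ℂ) ⊗ₖ traceFst S) * U
          = uᴴ * diagonal (fun b => (q b : ℂ)) * uᴴᴴ := by
        rw [hG, hu, conjTranspose_conjTranspose, conjTranspose_mul, conjTranspose_conjTranspose]
        simp only [Matrix.mul_assoc]
      rw [e, mul_diagonal_mul_conjTranspose_diag, Complex.ofReal_re]
      refine Finset.sum_congr rfl fun b _ => ?_
      rw [conjTranspose_apply, norm_star, inv_div]
      field_simp
  · have hlog : ∀ a b, p a * ‖u b a‖ ^ 2 * Real.log (p a / q b)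
        = p a * Real.log (p a) * ‖u b a‖ ^ 2 - p a * ‖u b a‖ ^ 2 * Real.log (q b) := by
      intro a b
      by_cases ha : p a = 0
      · simp [ha]
      by_cases hb : q b = 0
      · have := hsupp a b hb
        have h0 : ‖u b a‖ ^ 2 = 0 := by simpa [ha] using this
        rw [h0]; simp
      · rw [Real.log_div ha hb]; ring
    have hB : ∑ a, ∑ b, p a * ‖u b a‖ ^ 2 * Real.log (q b) = ∑ j, r j * Real.log (r j) := by
      rw [Finset.sum_comm, Fintype.sum_prod_type, Finset.sum_comm]
      refine Finset.sum_congr rfl fun j _ => ?_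
      rw [← hcol j, Finset.sum_mul]
      refine Finset.sum_congr rfl fun x _ => ?_
      rw [Finset.sum_mul, hqdef, hcol j]
    have hlog2 : Real.log 2 ≠ 0 := (Real.log_pos (by norm_num)).ne'
    simp only [hlog, Finset.sum_sub_distrib]
    rw [hB, vonNeumannEntropy, vonNeumannEntropy, hcfcS, hcfcσ, Complex.ofReal_re,
      Complex.ofReal_re]
    simp only [← Finset.mul_sum, hrow, mul_one, Real.negMulLog, neg_mul, Finset.sum_neg_distrib]
    field_simp
    ring

end

/-! ### Kraus operators -/

section
variable {d e κ : Type*} [Fintype d] [DecidableEq d] [Fintype e] [DecidableEq e]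
  [Fintype κ] [DecidableEq κ]

/-- `K`, with entries `K (y, k) a`, is a family of Kraus operators of `E`, indexed by `k`. -/
def IsKraus (K : Matrix (e × κ) d ℂ) (E : Matrix d d ℂ →ₗ[ℂ] Matrix e e ℂ) : Prop :=
  ∀ a b y y', E (Matrix.single a b 1) y y' = ∑ k, K (y, k) a * star (K (y', k) b)

open scoped MatrixOrder in
/-- Every completely positive map has Kraus operators: they are read off from a factorization of its
Choi matrix. -/
theorem exists_isKraus {E : Matrix d d ℂ →ₗ[ℂ] Matrix e e ℂ} (h : IsCPM E) :
    ∃ K : Matrix (e × (e × Fin (Fintype.card d))) d ℂ, IsKraus K E := by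
  let f := Fintype.equivFin d
  let ω : d × Fin (Fintype.card d) → ℂ := fun p => if f p.1 = p.2 then 1 else 0
  have hC := h _ _ (posSemidef_vecMulVec_self_star ω)
  obtain ⟨D, hD⟩ := CStarAlgebra.nonneg_iff_eq_star_mul_self.mp hC.nonneg
  refine ⟨Matrix.of fun q a => star (D q.2 (q.1, f a)), fun a b y y' => ?_⟩
  have e1 : ampliation E (vecMulVec ω (star ω)) (y, f a) (y', f b)
      = E (Matrix.single a b 1) y y' := by
    have e2 : (Matrix.of fun i j => vecMulVec ω (star ω) (i, f a) (j, f b))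
        = Matrix.single a b (1 : ℂ) := by
      ext i j
      simp only [ω, of_apply, vecMulVec_apply, Pi.star_apply, single_apply, f.injective.eq_iff]
      by_cases hi : i = a <;> by_cases hj : j = b <;>
        simp [hi, hj, eq_comm (a := a) (b := i), eq_comm (a := b) (b := j)]
    rw [ampliation, of_apply]
    exact congrFun (congrFun (congrArg E e2) y) y'
  rw [← e1, hD, mul_apply]
  refine Finset.sum_congr rfl fun k _ => ?_
  simp [star_apply]

variable {E : Matrix d d ℂ →ₗ[ℂ] Matrix e e ℂ} {K : Matrix (e × κ) d ℂ}

/-- The result of applying the tensor powers of Kraus operators to a vector, with one column for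
each sequence of Kraus operators. -/
def krausPow (ι : Type*) [Fintype ι] [DecidableEq ι] (K : Matrix (e × κ) d ℂ)
    (Φ : (ι → d) → ℂ) : Matrix (ι → e) (ι → κ) ℂ :=
  Matrix.of fun y k => ∑ w, (∏ i, K (y i, k i) (w i)) * Φ w

theorem krausPow_sum {ι τ : Type*} [Fintype ι] [DecidableEq ι] (s : Finset τ)
    (Φ : τ → (ι → d) → ℂ) :
    krausPow ι K (fun w => ∑ x ∈ s, Φ x w) = ∑ x ∈ s, krausPow ι K (Φ x) := by
  ext y k
  simp only [krausPow, of_apply, Matrix.sum_apply, Finset.mul_sum]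
  exact Finset.sum_comm

theorem tensorPowMap_ketBra (hK : IsKraus K E) (n : ℕ) (Ψ : EuclideanSpace ℂ (Fin n → d)) :
    tensorPowMap E n (ketBra Ψ) = krausPow (Fin n) K Ψ * (krausPow (Fin n) K Ψ)ᴴ := by
  ext x y
  simp only [tensorPowMap, of_apply, mul_apply, conjTranspose_apply, krausPow, hK _ _ _ _,
    Fintype.prod_sum, ketBra, star_sum, star_mul', star_prod, Finset.sum_mul_sum,
    Finset.prod_mul_distrib]
  rw [Finset.sum_comm' (t' := Finset.univ) (s' := fun _ => Finset.univ) (by simp)]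
  simp only [Finset.mul_sum]
  rw [Finset.sum_comm]
  conv_rhs => rw [Finset.sum_comm]
  refine Finset.sum_congr rfl fun a _ => ?_
  conv_rhs => rw [Finset.sum_comm]
  refine Finset.sum_congr rfl fun b _ => Finset.sum_congr rfl fun k _ => ?_
  ring

/-- The Kraus operators applied to a single vector. -/
def krausApply (K : Matrix (e × κ) d ℂ) (θ : d → ℂ) : Matrix e κ ℂ :=
  Matrix.of fun y k => ∑ a, K (y, k) a * θ a

theorem map_ketBra (hK : IsKraus K E) (θ : EuclideanSpace ℂ d) :
    E (ketBra θ) = krausApply K θ * (krausApply K θ)ᴴ := by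
  have e1 : ketBra θ = ∑ a, ∑ b, (θ a * star (θ b)) • Matrix.single a b (1 : ℂ) := by
    rw [matrix_eq_sum_single (ketBra θ)]
    refine Finset.sum_congr rfl fun a _ => Finset.sum_congr rfl fun b _ => ?_
    rw [smul_single, smul_eq_mul, mul_one]
    rfl
  ext y y'
  rw [e1]
  simp only [map_sum, map_smul, Matrix.sum_apply, Matrix.smul_apply, hK _ _ _ _, mul_apply,
    conjTranspose_apply, krausApply, of_apply, star_sum, star_mul', Finset.sum_mul_sum,
    smul_eq_mul]
  simp only [Finset.mul_sum]
  conv_rhs => rw [Finset.sum_comm]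
  refine Finset.sum_congr rfl fun a _ => ?_
  conv_rhs => rw [Finset.sum_comm]
  refine Finset.sum_congr rfl fun b _ => Finset.sum_congr rfl fun k _ => ?_
  ring

theorem krausPow_prod {ι : Type*} [Fintype ι] [DecidableEq ι] (θ : d → ℂ) :
    krausPow ι K (fun w => ∏ i, θ (w i)) = tensorPow ι (krausApply K θ) := by
  ext y k
  simp only [krausPow, tensorPow, krausApply, of_apply, Fintype.prod_sum, Finset.prod_mul_distrib]

theorem frobSq_krausPow (hK : IsKraus K E) (hE : IsTracePreserving E) {ι : Type*} [Fintype ι]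
    [DecidableEq ι] (Φ : (ι → d) → ℂ) : frobSq (krausPow ι K Φ) = ∑ w, ‖Φ w‖ ^ 2 := by
  have hiso : Kᴴ * K = 1 := by
    ext b a
    have h := hE (Matrix.single a b 1)
    rw [trace] at h
    simp only [diag_apply, hK _ _ _ _] at h
    rw [mul_apply, Fintype.sum_prod_type]
    simp only [conjTranspose_apply]
    have h2 : (Matrix.single a b (1 : ℂ)).trace = (1 : Matrix d d ℂ) b a := by
      by_cases hab : a = b
      · subst hab; simp
      · rw [trace_single_eq_of_ne _ _ _ hab, one_apply_ne (Ne.symm hab)]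
    rw [← h2, ← h]
    exact Finset.sum_congr rfl fun y _ => Finset.sum_congr rfl fun k _ => mul_comm _ _
  have hpow : (tensorPow ι K)ᴴ * tensorPow ι K = 1 := by
    rw [← tensorPow_conjTranspose, ← tensorPow_mul, hiso, tensorPow_one]
  have h := frobSq_unitary_mul hpow (Matrix.of fun w (_ : Unit) => Φ w)
  have hr : frobSq (Matrix.of fun w (_ : Unit) => Φ w) = ∑ w, ‖Φ w‖ ^ 2 := by
    simp [frobSq]
  rw [← hr, ← h, frobSq, frobSq,
    ← (Equiv.arrowProdEquivProdArrow ι (fun _ => e) fun _ => κ).symm.sum_comp,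
    Fintype.sum_prod_type]
  refine Finset.sum_congr rfl fun y _ => Finset.sum_congr rfl fun k _ => ?_
  simp only [krausPow, of_apply, mul_apply, tensorPow, Finset.univ_unique, Finset.sum_singleton]
  rfl

/-- Splitting of the indices of a tensor power according to a predicate on the factors. -/
abbrev splitIdx {ι : Type*} (p : ι → Prop) [DecidablePred p] (Y : Type*) :
    (ι → Y) ≃ ({i // p i} → Y) × ({i // ¬p i} → Y) :=
  Equiv.piEquivPiSubtypeProd p fun _ => Y

theorem prod_splitIdx {ι : Type*} [Fintype ι] [DecidableEq ι] (p : ι → Prop) [DecidablePred p]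
    (f : ι → ℂ) : ∏ i, f i = (∏ i : {i // p i}, f i) * ∏ i : {i // ¬p i}, f i :=
  (Fintype.prod_subtype_mul_prod_subtype p f).symm

/-- Product vectors are mapped to tensor products. -/
theorem krausPow_split {ι : Type*} [Fintype ι] [DecidableEq ι] (p : ι → Prop) [DecidablePred p]
    (α : ({i // p i} → d) → ℂ) (β : ({i // ¬p i} → d) → ℂ) :
    krausPow ι K (fun w => α (fun i => w i) * β (fun i => w i))
      = (krausPow _ K α ⊗ₖ krausPow _ K β).submatrix (splitIdx p e) (splitIdx p κ) := by
  ext y k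
  simp only [krausPow, of_apply, submatrix_apply, kroneckerMap_apply]
  rw [← (splitIdx p d).symm.sum_comp, Fintype.sum_prod_type, Finset.sum_mul_sum]
  refine Finset.sum_congr rfl fun w _ => Finset.sum_congr rfl fun w' _ => ?_
  have h1 : ∀ i : {i // p i}, (splitIdx p d).symm (w, w') i = w i := fun i => by
    simp [splitIdx, Equiv.piEquivPiSubtypeProd, i.2]
  have h2 : ∀ i : {i // ¬p i}, (splitIdx p d).symm (w, w') i = w' i := fun i => by
    simp [splitIdx, Equiv.piEquivPiSubtypeProd, i.2]
  rw [prod_splitIdx p]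
  simp only [h1, h2]
  simp only [splitIdx, Equiv.piEquivPiSubtypeProd, Equiv.coe_fn_mk]
  ring

end

/-! ### Replacing the first system by the identity -/

section
variable {X B : Type*} [Fintype X] [DecidableEq X] [Fintype B] [DecidableEq B]
variable {ι : Type*} [Fintype ι] [DecidableEq ι]

/-- The operator `1 ⊗ tr_{X^ι} ρ` for an operator `ρ` on `(X ⊗ B)^{⊗ι}`. -/
def idTrace (ρ : Matrix (ι → X × B) (ι → X × B) ℂ) : Matrix (ι → X × B) (ι → X × B) ℂ :=
  Matrix.of fun y y' => (∏ i, (1 : Matrix X X ℂ) (y i).1 (y' i).1) *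
    ∑ x : ι → X, ρ (fun i => (x i, (y i).2)) fun i => (x i, (y' i).2)

theorem idTrace_sum {τ : Type*} (s : Finset τ) (ρ : τ → Matrix (ι → X × B) (ι → X × B) ℂ) :
    idTrace (∑ x ∈ s, ρ x) = ∑ x ∈ s, idTrace (ρ x) := by
  ext y y'
  simp only [idTrace, of_apply, Matrix.sum_apply, Finset.mul_sum]
  exact Finset.sum_comm

/-- The identification of `(X ⊗ B)^{⊗ι}` with `X^{⊗ι} ⊗ B^{⊗ι}`. -/
abbrev prodIdx (ι X B : Type*) : (ι → X × B) ≃ (ι → X) × (ι → B) :=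
  Equiv.arrowProdEquivProdArrow ι (fun _ => X) fun _ => B

theorem idTrace_submatrix (ρ : Matrix (ι → X × B) (ι → X × B) ℂ) :
    (idTrace ρ).submatrix (prodIdx ι X B).symm (prodIdx ι X B).symm
      = (1 : Matrix (ι → X) (ι → X) ℂ) ⊗ₖ
        traceFst (ρ.submatrix (prodIdx ι X B).symm (prodIdx ι X B).symm) := by
  ext ⟨x, b⟩ ⟨x', b'⟩
  have h : ∏ i, (1 : Matrix X X ℂ) (x i) (x' i) = (1 : Matrix (ι → X) (ι → X) ℂ) x x' := by
    rw [← tensorPow_one]; rfl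
  simp only [submatrix_apply, idTrace, of_apply, kroneckerMap_apply, traceFst]
  rw [← h]
  rfl

theorem idTrace_tensorPow (S : Matrix (X × B) (X × B) ℂ) :
    idTrace (tensorPow ι S) = tensorPow ι ((1 : Matrix X X ℂ) ⊗ₖ traceFst S) := by
  ext y y'
  simp only [idTrace, tensorPow, of_apply, kroneckerMap_apply, traceFst, Finset.prod_mul_distrib,
    Fintype.prod_sum]

theorem idTrace_split (p : ι → Prop) [DecidablePred p]
    (α : Matrix ({i // p i} → X × B) ({i // p i} → X × B) ℂ)
    (β : Matrix ({i // ¬p i} → X × B) ({i // ¬p i} → X × B) ℂ) :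
    idTrace ((α ⊗ₖ β).submatrix (splitIdx p (X × B)) (splitIdx p (X × B)))
      = (idTrace α ⊗ₖ idTrace β).submatrix (splitIdx p (X × B)) (splitIdx p (X × B)) := by
  ext y y'
  simp only [idTrace, of_apply, submatrix_apply, kroneckerMap_apply]
  rw [← (splitIdx p X).symm.sum_comp, Fintype.sum_prod_type, prod_splitIdx p, mul_mul_mul_comm,
    Finset.sum_mul_sum]
  congr 1
  refine Finset.sum_congr rfl fun w _ => Finset.sum_congr rfl fun w' _ => ?_
  have h1 : ∀ i : {i // p i}, (splitIdx p X).symm (w, w') i = w i := fun i => by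
    simp [splitIdx, Equiv.piEquivPiSubtypeProd, i.2]
  have h2 : ∀ i : {i // ¬p i}, (splitIdx p X).symm (w, w') i = w' i := fun i => by
    simp [splitIdx, Equiv.piEquivPiSubtypeProd, i.2]
  simp only [splitIdx, Equiv.piEquivPiSubtypeProd, Equiv.coe_fn_mk] at h1 h2 ⊢
  simp only [h1, h2]

/-- An operator that is block diagonal with respect to rank-one blocks on the first system is
bounded by its marginal on the second. -/
theorem posSemidef_one_kronecker_sub {J a b : Type*} [Fintype J] [Fintype a]
    [DecidableEq a] [Fintype b] {Q : J → Matrix a a ℂ} {ω : J → Matrix b b ℂ}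
    (hQ : ∀ j, (Q j).PosSemidef) (hω : ∀ j, (ω j).PosSemidef) (hQ1 : ∑ j, Q j = 1)
    (htr : ∀ j, (Q j).trace = 1) :
    ((1 : Matrix a a ℂ) ⊗ₖ traceFst (∑ j, Q j ⊗ₖ ω j) - ∑ j, Q j ⊗ₖ ω j).PosSemidef := by
  classical
  have e : traceFst (∑ j, Q j ⊗ₖ ω j) = ∑ j, ω j := by
    ext i i'
    simp only [traceFst, of_apply, Matrix.sum_apply, kroneckerMap_apply]
    rw [Finset.sum_comm]
    refine Finset.sum_congr rfl fun j _ => ?_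
    rw [← Finset.sum_mul]
    have := htr j
    simp only [trace, diag_apply] at this
    rw [this, one_mul]
  have e2 : (1 : Matrix a a ℂ) ⊗ₖ traceFst (∑ j, Q j ⊗ₖ ω j) - ∑ j, Q j ⊗ₖ ω j
      = ∑ j, Q j ⊗ₖ ∑ j' ∈ Finset.univ.erase j, ω j' := by
    rw [e, ← hQ1]
    ext ⟨x, y⟩ ⟨x', y'⟩
    simp only [Matrix.sub_apply, Matrix.sum_apply, kroneckerMap_apply, Finset.sum_mul]
    rw [← Finset.sum_sub_distrib]
    refine Finset.sum_congr rfl fun j _ => ?_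
    rw [← mul_sub, Finset.sum_erase_eq_sub (Finset.mem_univ j)]
  rw [e2]
  exact posSemidef_sum _ fun j _ => (hQ j).kronecker (posSemidef_sum _ fun j' _ => hω j')

variable {d : Type*} [Fintype d] [DecidableEq d]

/-- The Kraus operators of a map that is classical on the first system, in the basis `c`. -/
noncomputable def classicalKraus {κ : Type*} (c : OrthonormalBasis X ℂ (EuclideanSpace ℂ X))
    (L : X → Matrix (B × κ) d ℂ) : Matrix ((X × B) × (X × κ)) d ℂ :=
  Matrix.of fun q a => c q.2.1 q.1.1 * L q.2.1 (q.1.2, q.2.2) a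

theorem isKraus_classicalKraus {κ : Type*} [Fintype κ] [DecidableEq κ]
    {c : OrthonormalBasis X ℂ (EuclideanSpace ℂ X)}
    {L : X → Matrix (B × κ) d ℂ} {E : Matrix d d ℂ →ₗ[ℂ] Matrix (X × B) (X × B) ℂ}
    {F : X → (Matrix d d ℂ →ₗ[ℂ] Matrix B B ℂ)} (hL : ∀ x, IsKraus (L x) (F x))
    (hE : ∀ S, E S = ∑ x, ketBra (c x) ⊗ₖ F x S) : IsKraus (classicalKraus c L) E := by
  intro a b y y'
  rw [hE, Matrix.sum_apply, Fintype.sum_prod_type]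
  refine Finset.sum_congr rfl fun x _ => ?_
  rw [kroneckerMap_apply, hL x, Finset.mul_sum]
  refine Finset.sum_congr rfl fun k _ => ?_
  simp only [classicalKraus, ketBra, of_apply, star_mul']
  ring

theorem sum_basis_mul_star (c : OrthonormalBasis X ℂ (EuclideanSpace ℂ X)) (y y' : X) :
    ∑ x, c x y * star (c x y') = (1 : Matrix X X ℂ) y y' := by
  have h := (EuclideanSpace.basisFun X ℂ).toMatrix_orthonormalBasis_mem_unitary c
  rw [← mem_unitaryGroup_iff.1 h, mul_apply]
  rfl

theorem sum_star_mul_basis (c : OrthonormalBasis X ℂ (EuclideanSpace ℂ X)) (x : X) :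
    ∑ y, c x y * star (c x y) = 1 := by
  have h := (EuclideanSpace.basisFun X ℂ).toMatrix_orthonormalBasis_mem_unitary c
  have h2 := congrFun (congrFun (mem_unitaryGroup_iff'.1 h) x) x
  rw [one_apply_eq, mul_apply] at h2
  rw [← h2]
  exact Finset.sum_congr rfl fun y _ => mul_comm _ _

/-- The output of a tensor power of a classical map is bounded by its marginal on the second
systems. -/
theorem posSemidef_idTrace_sub_krausPow {κ : Type*} [Fintype κ] [DecidableEq κ]
    (c : OrthonormalBasis X ℂ (EuclideanSpace ℂ X)) (L : X → Matrix (B × κ) d ℂ)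
    (Φ : (ι → d) → ℂ) :
    (idTrace (krausPow ι (classicalKraus c L) Φ * (krausPow ι (classicalKraus c L) Φ)ᴴ)
      - krausPow ι (classicalKraus c L) Φ * (krausPow ι (classicalKraus c L) Φ)ᴴ).PosSemidef := by
  set A := krausPow ι (classicalKraus c L) Φ with hA
  let v : (ι → X) → (ι → X) → ℂ := fun x y => ∏ i, c (x i) (y i)
  let C : (ι → X) → Matrix (ι → B) (ι → κ) ℂ := fun x =>
    Matrix.of fun b k => ∑ w, (∏ i, L (x i) (b i, k i) (w i)) * Φ w
  have hAe : ∀ y x k, A y (fun i => (x i, k i))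
      = v x (fun i => (y i).1) * C x (fun i => (y i).2) k := by
    intro y x k
    simp only [hA, krausPow, classicalKraus, of_apply, v, C, Finset.prod_mul_distrib,
      Finset.mul_sum, mul_assoc]
  -- the output is block diagonal in the product basis `v`
  have hsplit : (A * Aᴴ).submatrix (prodIdx ι X B).symm (prodIdx ι X B).symm
      = ∑ x, vecMulVec (v x) (star (v x)) ⊗ₖ (C x * (C x)ᴴ) := by
    ext ⟨y, b⟩ ⟨y', b'⟩
    rw [submatrix_apply, mul_apply, ← (prodIdx ι X κ).symm.sum_comp, Fintype.sum_prod_type,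
      Matrix.sum_apply]
    refine Finset.sum_congr rfl fun x _ => ?_
    rw [kroneckerMap_apply, mul_apply, Finset.mul_sum]
    refine Finset.sum_congr rfl fun k _ => ?_
    rw [conjTranspose_apply, conjTranspose_apply, vecMulVec_apply, Pi.star_apply]
    change A _ (fun i => (x i, k i)) * star (A _ (fun i => (x i, k i))) = _
    rw [hAe, hAe, star_mul']
    simp only [prodIdx, Equiv.arrowProdEquivProdArrow, Equiv.coe_fn_symm_mk]
    ring
  have hQ1 : ∑ x, vecMulVec (v x) (star (v x)) = 1 := by
    ext y y'
    rw [← tensorPow_one, Matrix.sum_apply, tensorPow, of_apply]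
    simp only [← sum_basis_mul_star c, Fintype.prod_sum, vecMulVec_apply, Pi.star_apply, v,
      star_prod, Finset.prod_mul_distrib]
  have htr : ∀ x, (vecMulVec (v x) (star (v x))).trace = 1 := by
    intro x
    simp only [trace, diag_apply, vecMulVec_apply, Pi.star_apply, v, star_prod,
      ← Finset.prod_mul_distrib]
    rw [← Fintype.prod_sum (fun i y => c (x i) y * star (c (x i) y))]
    simp only [sum_star_mul_basis, Finset.prod_const_one]
  have h := posSemidef_one_kronecker_sub (Q := fun x => vecMulVec (v x) (star (v x)))
    (ω := fun x => C x * (C x)ᴴ) (fun x => posSemidef_vecMulVec_self_star _)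
    (fun x => posSemidef_self_mul_conjTranspose _) hQ1 htr
  rw [← hsplit, ← idTrace_submatrix] at h
  exact (posSemidef_submatrix_equiv (prodIdx ι X B).symm).1 h

end

/-! ### Decomposition of almost-product vectors -/

section
variable {d : Type*} [Fintype d] [DecidableEq d] {n : ℕ}

/-- The product of the projectors `1 - |θ⟩⟨θ|` on the factors in `J` and `|θ⟩⟨θ|` on the others. -/
def patternProj (θ : EuclideanSpace ℂ d) (J : Finset (Fin n)) :
    Matrix (Fin n → d) (Fin n → d) ℂ :=
  Matrix.of fun w w' => ∏ i, (if i ∈ J then 1 - ketBra θ else ketBra θ) (w i) (w' i)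

theorem ketBra_conjTranspose (θ : EuclideanSpace ℂ d) : (ketBra θ)ᴴ = ketBra θ := by
  ext i j
  simp [ketBra, mul_comm]

theorem sum_star_mul_self {θ : EuclideanSpace ℂ d} (hθ : ‖θ‖ = 1) :
    ∑ a, star (θ a) * θ a = 1 := by
  have h := EuclideanSpace.norm_sq_eq θ
  rw [hθ, one_pow] at h
  have h2 : ∀ a, star (θ a) * θ a = ((‖θ a‖ ^ 2 : ℝ) : ℂ) := fun a => by
    rw [Complex.ofReal_pow]
    exact RCLike.conj_mul (θ a)
  simp only [h2, ← Complex.ofReal_sum, ← h, Complex.ofReal_one]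

theorem ketBra_mul_self {θ : EuclideanSpace ℂ d} (hθ : ‖θ‖ = 1) :
    ketBra θ * ketBra θ = ketBra θ := by
  ext i j
  simp only [mul_apply, ketBra, of_apply]
  calc ∑ x, θ i * star (θ x) * (θ x * star (θ j))
      = θ i * (∑ x, star (θ x) * θ x) * star (θ j) := by
        rw [Finset.mul_sum, Finset.sum_mul]
        exact Finset.sum_congr rfl fun x _ => by ring
    _ = _ := by rw [sum_star_mul_self hθ, mul_one]

theorem sum_one_sub_ketBra {θ : EuclideanSpace ℂ d} (hθ : ‖θ‖ = 1) (x : d) :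
    ∑ a, (1 - ketBra θ) x a * θ a = 0 := by
  simp only [Matrix.sub_apply, ketBra, of_apply, sub_mul, Finset.sum_sub_distrib, mul_assoc,
    ← Finset.mul_sum, sum_star_mul_self hθ, mul_one]
  simp [one_apply]

theorem sum_patternProj (θ : EuclideanSpace ℂ d) :
    ∑ J : Finset (Fin n), patternProj θ J = 1 := by
  ext w w'
  rw [Matrix.sum_apply, ← tensorPow_one, tensorPow, of_apply]
  have h : ∀ i, (1 : Matrix d d ℂ) (w i) (w' i)
      = (1 - ketBra θ) (w i) (w' i) + ketBra θ (w i) (w' i) := fun i => by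
    rw [Matrix.sub_apply, sub_add_cancel]
  simp only [h, Fintype.prod_add]
  refine Finset.sum_congr rfl fun J _ => ?_
  rw [patternProj, of_apply, ← Finset.prod_mul_prod_compl J]
  congr 1
  · exact Finset.prod_congr rfl fun i hi => by rw [if_pos hi]
  · exact Finset.prod_congr rfl fun i hi => by rw [if_neg (Finset.mem_compl.1 hi)]

theorem patternProj_conjTranspose (θ : EuclideanSpace ℂ d) (J : Finset (Fin n)) :
    (patternProj θ J)ᴴ = patternProj θ J := by
  ext w w'
  simp only [patternProj, conjTranspose_apply, of_apply, star_prod]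
  refine Finset.prod_congr rfl fun i _ => ?_
  rw [← conjTranspose_apply]
  split_ifs
  · rw [conjTranspose_sub, conjTranspose_one, ketBra_conjTranspose]
  · rw [ketBra_conjTranspose]

theorem patternProj_mul_of_ne {θ : EuclideanSpace ℂ d} (hθ : ‖θ‖ = 1) {J J' : Finset (Fin n)}
    (h : J ≠ J') : patternProj θ J * patternProj θ J' = 0 := by
  have hPP := ketBra_mul_self hθ
  obtain ⟨i, hi⟩ : ∃ i, ¬(i ∈ J ↔ i ∈ J') := by
    by_contra! hc
    exact h (Finset.ext hc)
  ext w w'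
  simp only [mul_apply, patternProj, of_apply, ← Finset.prod_mul_distrib, Matrix.zero_apply]
  rw [← Fintype.prod_sum (fun i a => (if i ∈ J then 1 - ketBra θ else ketBra θ) (w i) a *
    (if i ∈ J' then 1 - ketBra θ else ketBra θ) a (w' i))]
  refine Finset.prod_eq_zero (Finset.mem_univ i) ?_
  rw [← mul_apply]
  by_cases h1 : i ∈ J
  · have h2 : i ∉ J' := fun h2 => hi ⟨fun _ => h2, fun _ => h1⟩
    rw [if_pos h1, if_neg h2, Matrix.sub_mul, Matrix.one_mul, hPP, sub_self, Matrix.zero_apply]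
  · have h2 : i ∈ J' := by
      by_contra h2
      exact hi ⟨fun h => absurd h h1, fun h => absurd h h2⟩
    rw [if_neg h1, if_pos h2, Matrix.mul_sub, Matrix.mul_one, hPP, sub_self, Matrix.zero_apply]

/-- A vector with `θ` on the factors satisfying `p` is annihilated as soon as one of these factors
is projected onto the complement of `θ`. -/
theorem patternProj_mulVec_eq_zero {θ : EuclideanSpace ℂ d} (hθ : ‖θ‖ = 1) {J : Finset (Fin n)}
    (p : Fin n → Prop) [DecidablePred p] {i₀ : Fin n} (hp : p i₀) (hJ : i₀ ∈ J)
    (β : ({i // ¬p i} → d) → ℂ) :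
    patternProj θ J *ᵥ (fun w => (∏ i : {i // p i}, θ (w i)) * β fun i => w i) = 0 := by
  ext w
  simp only [mulVec, dotProduct, patternProj, of_apply, Pi.zero_apply]
  rw [← (splitIdx p d).symm.sum_comp, Fintype.sum_prod_type, Finset.sum_comm]
  refine Finset.sum_eq_zero fun v' _ => ?_
  have h1 : ∀ (v : {i // p i} → d) (i : {i // p i}), (splitIdx p d).symm (v, v') i = v i :=
    fun v i => by simp [splitIdx, Equiv.piEquivPiSubtypeProd, i.2]
  have h2 : ∀ (v : {i // p i} → d) (i : {i // ¬p i}), (splitIdx p d).symm (v, v') i = v' i :=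
    fun v i => by simp [splitIdx, Equiv.piEquivPiSubtypeProd, i.2]
  simp only [prod_splitIdx p, h1, h2]
  have h3 : ∑ v : {i // p i} → d, ∏ i : {i // p i},
      ((if i.1 ∈ J then 1 - ketBra θ else ketBra θ) (w i) (v i) * θ (v i)) = 0 := by
    rw [← Fintype.prod_sum (fun (i : {i // p i}) a =>
      (if i.1 ∈ J then 1 - ketBra θ else ketBra θ) (w i) a * θ a)]
    refine Finset.prod_eq_zero (Finset.mem_univ ⟨i₀, hp⟩) ?_
    rw [if_pos hJ]
    exact sum_one_sub_ketBra hθ _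
  simp only [Finset.prod_mul_distrib] at h3
  calc _ = (∑ v : {i // p i} → d, (∏ i : {i // p i},
        (if i.1 ∈ J then 1 - ketBra θ else ketBra θ) (w i) (v i)) * ∏ i, θ (v i)) *
          ((∏ i : {i // ¬p i}, (if i.1 ∈ J then 1 - ketBra θ else ketBra θ) (w i) (v' i)) *
            β v') := by
        rw [Finset.sum_mul]
        exact Finset.sum_congr rfl fun v _ => by ring
    _ = 0 := by rw [h3, zero_mul]

/-- A set of more than `r` factors contains one of the `n - r` factors that carry `θ`. -/
theorem patternProj_mulVec_of_mem_span {θ : EuclideanSpace ℂ d} (hθ : ‖θ‖ = 1) {r : ℕ}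
    (hr : r ≤ n) {J : Finset (Fin n)} (hJ : r < J.card) {Ψ : EuclideanSpace ℂ (Fin n → d)}
    (hΨ : Ψ ∈ Submodule.span ℂ (almostProductVectors n θ (n - r))) :
    patternProj θ J *ᵥ Ψ = 0 := by
  induction hΨ using Submodule.span_induction with
  | mem Φ hΦ =>
    obtain ⟨π, χ, rfl⟩ := hΦ
    let p : Fin n → Prop := fun i => (π.symm i).val < n - r
    have hp : ∀ i, p (π i) ↔ i.val < n - r := fun i => by simp [p]
    obtain ⟨i₀, hi₀J, hi₀⟩ : ∃ i ∈ J, p i := by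
      by_contra! hc
      have h1 : J ⊆ (Finset.univ.filter fun i : Fin n => n - r ≤ i.val).map π.toEmbedding := by
        intro i hi
        rw [Finset.mem_map_equiv, Finset.mem_filter]
        exact ⟨Finset.mem_univ _, not_lt.1 (hc i hi)⟩
      have h2 := Finset.card_le_card h1
      have h3 : (Finset.univ.filter fun i : Fin n => n - r ≤ i.val).card ≤ r := by
        have h4 : (Finset.univ.filter fun i : Fin n => n - r ≤ i.val).card
            ≤ (Finset.Ico (n - r) n).card := by
          refine Finset.card_le_card_of_injOn (fun i => i.val) (fun i hi => ?_)
            (fun i _ j _ h => Fin.ext h)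
          have := (Finset.mem_filter.1 hi).2
          exact Finset.mem_coe.2 (Finset.mem_Ico.2 ⟨this, i.2⟩)
        rw [Nat.card_Ico] at h4
        omega
      rw [Finset.card_map] at h2
      omega
    convert patternProj_mulVec_eq_zero hθ p hi₀ hi₀J
      (fun v => χ fun j => v ⟨π j, fun h => absurd ((hp _).1 h) (not_lt.2 j.2)⟩) using 2
    ext w
    simp only [permuteFactors, tensorPowTensor]
    congr 1
    exact Fintype.prod_equiv (π.subtypeEquiv fun i => (hp i).symm) _ _ fun i => rfl
  | zero => simp
  | add Φ Φ' _ _ h h' => rw [WithLp.ofLp_add, mulVec_add, h, h', add_zero]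
  | smul c Φ _ h => rw [WithLp.ofLp_smul, mulVec_smul, h, smul_zero]

/-- After projecting the factors outside `J ⊆ T` onto `θ`, a vector has the form
`θ^{⊗Tᶜ} ⊗ β`. -/
theorem exists_patternProj_mulVec_eq (θ : EuclideanSpace ℂ d) {J T : Finset (Fin n)} (h : J ⊆ T)
    (Ψ : (Fin n → d) → ℂ) : ∃ β : ({i // ¬i ∉ T} → d) → ℂ,
      patternProj θ J *ᵥ Ψ = fun w => (∏ i : {i // i ∉ T}, θ (w i)) * β fun i => w i := by
  refine ⟨fun v => ∑ w', (∏ i : {i // i ∉ T}, star (θ (w' i))) *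
    (∏ i : {i // ¬i ∉ T}, (if i.1 ∈ J then 1 - ketBra θ else ketBra θ) (v i) (w' i)) * Ψ w', ?_⟩
  ext w
  simp only [mulVec, dotProduct, patternProj, of_apply, Finset.mul_sum]
  refine Finset.sum_congr rfl fun w' _ => ?_
  rw [prod_splitIdx fun i => i ∉ T]
  have e : ∏ i : {i // i ∉ T}, (if i.1 ∈ J then 1 - ketBra θ else ketBra θ) (w i) (w' i)
      = (∏ i : {i // i ∉ T}, θ (w i)) * ∏ i : {i // i ∉ T}, star (θ (w' i)) := by
    rw [← Finset.prod_mul_distrib]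
    refine Finset.prod_congr rfl fun i _ => ?_
    rw [if_neg fun hi => i.2 (h hi)]
    rfl
  rw [e]
  ring

theorem sum_normSq_sum_of_orthogonal {Z τ : Type*} [Fintype Z] (s : Finset τ) (v : τ → Z → ℂ)
    (h : ∀ x ∈ s, ∀ y ∈ s, x ≠ y → star (v x) ⬝ᵥ v y = 0) :
    ∑ w, ‖∑ x ∈ s, v x w‖ ^ 2 = ∑ x ∈ s, ∑ w, ‖v x w‖ ^ 2 := by
  have e : ∀ f : Z → ℂ, ((∑ w, ‖f w‖ ^ 2 : ℝ) : ℂ) = star f ⬝ᵥ f := by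
    intro f
    push_cast
    exact Finset.sum_congr rfl fun w _ => (RCLike.conj_mul (f w)).symm
  have h1 : ((∑ w, ‖∑ x ∈ s, v x w‖ ^ 2 : ℝ) : ℂ) = ((∑ x ∈ s, ∑ w, ‖v x w‖ ^ 2 : ℝ) : ℂ) := by
    have e1 : (fun w => ∑ x ∈ s, v x w) = ∑ x ∈ s, v x := by ext w; simp
    have := e fun w => ∑ x ∈ s, v x w
    rw [this, e1, star_sum, sum_dotProduct, Complex.ofReal_sum]
    refine Finset.sum_congr rfl fun x hx => ?_
    rw [dotProduct_sum, e, Finset.sum_eq_single_of_mem x hx fun y hy hyx => h x hx y hy hyx.symm]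
  exact_mod_cast h1

/-- An almost-product vector is an orthogonal sum of vectors `θ^{⊗Tᶜ} ⊗ β_T`, where `T` runs over
the `r`-element sets of factors. -/
theorem exists_decomposition {θ : EuclideanSpace ℂ d} (hθ : ‖θ‖ = 1) {r : ℕ} (hr : r ≤ n)
    {Ψ : EuclideanSpace ℂ (Fin n → d)}
    (hΨ : Ψ ∈ Submodule.span ℂ (almostProductVectors n θ (n - r))) :
    ∃ β : (T : Finset (Fin n)) → ({i // ¬i ∉ T} → d) → ℂ,
      (∀ w, Ψ w = ∑ T ∈ Finset.powersetCard r Finset.univ,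
        (∏ i : {i // i ∉ T}, θ (w i)) * β T fun i => w i) ∧
      ∑ T ∈ Finset.powersetCard r Finset.univ,
        ∑ w : Fin n → d, ‖(∏ i : {i // i ∉ T}, θ (w i)) * β T fun i => w i‖ ^ 2 = ‖Ψ‖ ^ 2 := by
  -- patterns with at most `r` factors off `θ` are grouped by an `r`-element superset `f J`
  let s : Finset (Finset (Fin n)) := Finset.univ.filter fun J => J.card ≤ r
  have hsup : ∀ J : Finset (Fin n), ∃ T, J ∈ s → J ⊆ T ∧ T.card = r := by
    intro J
    by_cases hJ : J ∈ s
    · obtain ⟨T, h1, h2⟩ := Finset.exists_superset_card_eq (Finset.mem_filter.1 hJ).2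
        (by simpa using hr)
      exact ⟨T, fun _ => ⟨h1, h2⟩⟩
    · exact ⟨J, fun h => absurd h hJ⟩
  choose f hf using hsup
  let v : Finset (Fin n) → (Fin n → d) → ℂ := fun J => patternProj θ J *ᵥ Ψ
  have hmaps : ∀ J ∈ s, f J ∈ Finset.powersetCard r (Finset.univ : Finset (Fin n)) :=
    fun J hJ => Finset.mem_powersetCard.2 ⟨Finset.subset_univ _, (hf J hJ).2⟩
  have hex : ∀ T J, ∃ β : ({i // ¬i ∉ T} → d) → ℂ, J ∈ s.filter (fun J => f J = T) →
      v J = fun w => (∏ i : {i // i ∉ T}, θ (w i)) * β fun i => w i := by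
    intro T J
    by_cases hJ : J ∈ s.filter (fun J => f J = T)
    · obtain ⟨h1, h2⟩ := Finset.mem_filter.1 hJ
      obtain ⟨β, hβ⟩ := exists_patternProj_mulVec_eq θ (h2 ▸ (hf J h1).1) Ψ
      exact ⟨β, fun _ => hβ⟩
    · exact ⟨0, fun h => absurd h hJ⟩
  choose β hβ using hex
  have hΦ : ∀ T w, (∏ i : {i // i ∉ T}, θ (w i)) *
      (∑ J ∈ s.filter (fun J => f J = T), β T J fun i => w i)
        = ∑ J ∈ s.filter (fun J => f J = T), v J w := by
    intro T w
    rw [Finset.mul_sum]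
    exact Finset.sum_congr rfl fun J hJ => by rw [hβ T J hJ]
  have horth : ∀ J J', J ≠ J' → star (v J) ⬝ᵥ v J' = 0 := by
    intro J J' h
    simp only [v]
    rw [star_mulVec, patternProj_conjTranspose, ← dotProduct_mulVec, mulVec_mulVec,
      patternProj_mul_of_ne hθ h, zero_mulVec, dotProduct_zero]
  have hsum : ∀ w, Ψ w = ∑ J ∈ s, v J w := by
    intro w
    have h1 : (∑ J, patternProj θ J) *ᵥ (Ψ : (Fin n → d) → ℂ) = Ψ := by
      rw [sum_patternProj, one_mulVec]
    have h2 : ∑ J, v J w = Ψ w := by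
      rw [sum_mulVec] at h1
      conv_rhs => rw [← h1]
      rw [Finset.sum_apply]
    rw [← h2, Finset.sum_filter_of_ne]
    intro J _ hJ
    by_contra hc
    exact hJ (congrFun (patternProj_mulVec_of_mem_span hθ hr (not_le.1 hc) hΨ) w)
  refine ⟨fun T u => ∑ J ∈ s.filter (fun J => f J = T), β T J u, fun w => ?_, ?_⟩
  · simp only [hΦ]
    rw [Finset.sum_fiberwise_of_maps_to hmaps, hsum]
  · simp only [hΦ]
    rw [EuclideanSpace.norm_sq_eq]
    simp only [hsum]
    rw [sum_normSq_sum_of_orthogonal s v fun x _ y _ h => horth x y h,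
      ← Finset.sum_fiberwise_of_maps_to hmaps]
    exact Finset.sum_congr rfl fun T _ =>
      sum_normSq_sum_of_orthogonal _ v fun x _ y _ h => horth x y h

end

/-! ### The parameters -/

section
variable {n r : ℕ} {ε D H : ℝ}

theorem le_sqrt_of_le_one_of_le {x Λ : ℝ} (h0 : 0 ≤ x) (h1 : x ≤ 1) (h : x ≤ Λ) : x ≤ √Λ :=
  Real.le_sqrt_of_sq_le (by nlinarith)

/-- The failure probability of the smoothing is small enough, even after multiplication with the
number of terms in the decomposition. -/
theorem choose_mul_failure_le (hn : 0 < n) (hr : r ≤ n) (hε : 0 < ε) (hD : 1 ≤ D)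
    {Λ : ℝ} (hΛ : Λ = 2 * Real.logb 2 (4 / ε) / n + binaryEntropy ((r : ℝ) / n)) (hΛ0 : 0 ≤ Λ) :
    (n.choose r : ℝ) *
      ((2 : ℝ) ^ (-(((n - r : ℕ) : ℝ) * H - n * (2 * Real.logb 2 D + 3) * √Λ))) ^
          (-(√Λ / Real.log (4 * D))) *
        Real.exp (√Λ / Real.log (4 * D) * (-(Real.log 2 * H)) + 3 / 4 * √Λ ^ 2) ^ (n - r)
      ≤ (ε / 4) ^ 2 := by
  have hn' : (0 : ℝ) < n := by exact_mod_cast hn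
  have hl2 : 0 < Real.log 2 := Real.log_pos (by norm_num)
  have hlD : 0 ≤ Real.log D := Real.log_nonneg hD
  have hl4D : Real.log (4 * D) = 2 * Real.log 2 + Real.log D := by
    rw [Real.log_mul (by norm_num) (by linarith), show (4 : ℝ) = 2 ^ 2 by norm_num, Real.log_pow]
    norm_num
  have hpos : 0 < Real.log (4 * D) := by rw [hl4D]; linarith
  have hsq : √Λ * √Λ = Λ := Real.mul_self_sqrt hΛ0
  set s := √Λ / Real.log (4 * D) with hs
  have hsl : s * Real.log (4 * D) = √Λ := div_mul_cancel₀ _ hpos.ne'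
  have hs0 : 0 ≤ s := div_nonneg (Real.sqrt_nonneg _) hpos.le
  have hlb : Real.log 2 * Real.logb 2 D = Real.log D := by
    rw [Real.logb]; field_simp
  -- the deviation outweighs both the second order term and `log 2 * n * Λ`
  have hmain : Real.log 2 * ((((n - r : ℕ) : ℝ) * H - n * (2 * Real.logb 2 D + 3) * √Λ) * s)
      + ((n - r : ℕ) : ℝ) * (s * (-(Real.log 2 * H)) + 3 / 4 * √Λ ^ 2)
      ≤ -(Real.log 2 * (n * Λ)) := by
    have h1 : Real.log 2 * (n * (2 * Real.logb 2 D + 3) * √Λ * s)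
        = n * (√Λ * s) * (2 * Real.log D + 3 * Real.log 2) := by
      rw [← hlb]; ring
    have h2 : 3 / 2 * Λ ≤ √Λ * s * (2 * Real.log D + 3 * Real.log 2) := by
      have h3 : √Λ * s * Real.log (4 * D) = Λ := by rw [mul_assoc, hsl, hsq]
      have h4 : 0 ≤ √Λ * s := mul_nonneg (Real.sqrt_nonneg _) hs0
      rw [hl4D] at h3
      nlinarith
    have h5 : ((n - r : ℕ) : ℝ) ≤ n := by exact_mod_cast Nat.sub_le n r
    have h6 : Real.log 2 < 3 / 4 := by linarith [Real.log_two_lt_d9]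
    rw [Real.sq_sqrt hΛ0]
    have h7 : ((n - r : ℕ) : ℝ) * Λ ≤ n * Λ := mul_le_mul_of_nonneg_right h5 hΛ0
    have h8 : n * (3 / 2 * Λ) ≤ n * (√Λ * s * (2 * Real.log D + 3 * Real.log 2)) :=
      mul_le_mul_of_nonneg_left h2 hn'.le
    have h9 : Real.log 2 * (n * Λ) ≤ 3 / 4 * (n * Λ) :=
      mul_le_mul_of_nonneg_right h6.le (by positivity)
    nlinarith
  have e1 : ((2 : ℝ) ^ (-(((n - r : ℕ) : ℝ) * H - n * (2 * Real.logb 2 D + 3) * √Λ))) ^ (-s)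
      * Real.exp (s * (-(Real.log 2 * H)) + 3 / 4 * √Λ ^ 2) ^ (n - r)
      ≤ Real.exp (-(Real.log 2 * (n * Λ))) := by
    rw [← Real.rpow_mul (by norm_num), Real.rpow_def_of_pos (by norm_num), neg_mul_neg,
      ← Real.exp_nat_mul, ← Real.exp_add]
    exact Real.exp_le_exp.2 hmain
  have e2 : Real.exp (-(Real.log 2 * (n * Λ)))
      = (2 ^ ((n : ℝ) * binaryEntropy ((r : ℝ) / n)))⁻¹ * (ε / 4) ^ 2 := by
    have h1 : (n : ℝ) * Λ
        = 2 * Real.logb 2 (4 / ε) + n * binaryEntropy ((r : ℝ) / n) := by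
      rw [hΛ]; field_simp
    have h2 : Real.exp (Real.log 2 * Real.logb 2 (4 / ε)) = 4 / ε := by
      rw [Real.logb, mul_div_cancel₀ _ hl2.ne', Real.exp_log (by positivity)]
    rw [h1, mul_add, neg_add, Real.exp_add, Real.exp_neg, Real.exp_neg,
      Real.rpow_def_of_pos (by norm_num),
      show Real.log 2 * (2 * Real.logb 2 (4 / ε))
        = Real.log 2 * Real.logb 2 (4 / ε) + Real.log 2 * Real.logb 2 (4 / ε) by ring,
      Real.exp_add, h2]
    field_simp
  have e3 := choose_le_two_rpow_binaryEntropy hn hr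
  have hP : (0 : ℝ) < 2 ^ ((n : ℝ) * binaryEntropy ((r : ℝ) / n)) := by positivity
  rw [mul_assoc]
  calc _ ≤ 2 ^ ((n : ℝ) * binaryEntropy ((r : ℝ) / n)) *
        ((2 ^ ((n : ℝ) * binaryEntropy ((r : ℝ) / n)))⁻¹ * (ε / 4) ^ 2) :=
        mul_le_mul e3 (e1.trans_eq e2) (by positivity) hP.le
    _ = (ε / 4) ^ 2 := by rw [← mul_assoc, mul_inv_cancel₀ hP.ne', one_mul]

/-- The total loss: the number of terms costs `h(r/n) ≤ √Λ` per factor, and the `r` factors that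
are not smoothed cost at most `Hmax` each, where `r / n ≤ √Λ / 2`. -/
theorem le_neg_logb_choose_mul (hn : 0 < n) (hr : (r : ℝ) ≤ 1 / 2 * n)
    (hD : 1 ≤ D) (hH : H ≤ Real.logb 2 D) {Λ : ℝ}
    (hΛ : binaryEntropy ((r : ℝ) / n) ≤ Λ) :
    (n : ℝ) * (H - (5 / 2 * Real.logb 2 D + 4) * √Λ) ≤
      -Real.logb 2 ((n.choose r : ℝ) *
        2 ^ (-(((n - r : ℕ) : ℝ) * H - n * (2 * Real.logb 2 D + 3) * √Λ))) := by
  have hn' : (0 : ℝ) < n := by exact_mod_cast hn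
  have hrn : r ≤ n := by
    have : (r : ℝ) ≤ n := by linarith
    exact_mod_cast this
  have hN : (0 : ℝ) < n.choose r := by exact_mod_cast Nat.choose_pos hrn
  set p : ℝ := (r : ℝ) / n with hp
  have hp0 : 0 ≤ p := by positivity
  have hp1 : p ≤ 1 / 2 := by rw [hp, div_le_iff₀ hn']; exact hr
  have hrp : (r : ℝ) = n * p := by rw [hp]; field_simp
  have hh := two_mul_le_binaryEntropy hp0 hp1
  have h1 : binaryEntropy p ≤ √Λ :=
    le_sqrt_of_le_one_of_le (by linarith) (binaryEntropy_le_one p) hΛ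
  have h2 : 2 * p ≤ √Λ := le_sqrt_of_le_one_of_le (by linarith) (by linarith) (hh.trans hΛ)
  have hlD : 0 ≤ Real.logb 2 D := Real.logb_nonneg (by norm_num) hD
  have hlN : Real.logb 2 (n.choose r : ℝ) ≤ n * binaryEntropy p := by
    rw [Real.logb_le_iff_le_rpow (by norm_num) hN]
    exact choose_le_two_rpow_binaryEntropy hn hrn
  rw [Real.logb_mul hN.ne' (by positivity), Real.logb_rpow (by norm_num) (by norm_num),
    Nat.cast_sub hrn, hrp]
  have h3 : p * H ≤ p * Real.logb 2 D := mul_le_mul_of_nonneg_left hH hp0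
  have h4 : p * Real.logb 2 D ≤ √Λ / 2 * Real.logb 2 D :=
    mul_le_mul_of_nonneg_right (by linarith) hlD
  have h5 : n * (p * H + binaryEntropy p) ≤ n * (√Λ / 2 * Real.logb 2 D + √Λ) :=
    mul_le_mul_of_nonneg_left (by linarith) hn'.le
  nlinarith

end

/-! ### Smoothing the output state -/

section
variable {X B : Type*} [Fintype X] [DecidableEq X] [Fintype B] [DecidableEq B]
variable {d : Type*} [Fintype d] [DecidableEq d]

theorem traceFst_posSemidef {S : Matrix (X × B) (X × B) ℂ} (hS : S.PosSemidef) :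
    (traceFst S).PosSemidef := by
  have e : traceFst S = ∑ x, S.submatrix (fun b => (x, b)) fun b => (x, b) := by
    ext i j
    simp [traceFst, Matrix.sum_apply]
  rw [e]
  exact posSemidef_sum _ fun x _ => hS.submatrix _

theorem le_smoothMinEntropy {a b : Type*} [Fintype a] [DecidableEq a] [Fintype b] [DecidableEq b]
    {ε t : ℝ} {ρ ρ' : Matrix (a × b) (a × b) ℂ} {σ : Matrix b b ℂ} (hσ : σ.PosSemidef)
    (hσ1 : σ.trace = 1) (hρ' : ρ' ∈ smoothingBall ε ρ) (ht : 0 < t)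
    (h : (t • ((1 : Matrix a a ℂ) ⊗ₖ σ) - ρ').PosSemidef) :
    ((-Real.logb 2 t : ℝ) : EReal) ≤ smoothMinEntropy ε ρ :=
  le_iSup₂_of_le σ ⟨hσ, hσ1⟩ (le_iSup₂_of_le ρ' hρ' (le_iSup₂_of_le t ⟨ht, h⟩ le_rfl))

variable {κ : Type*} [Fintype κ] [DecidableEq κ] {c : OrthonormalBasis X ℂ (EuclideanSpace ℂ X)}
  {L : X → Matrix (B × κ) d ℂ} {E : Matrix d d ℂ →ₗ[ℂ] Matrix (X × B) (X × B) ℂ}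

/-- Smoothing one term of the decomposition: the operator `M` that smooths the tensor power of
`E(|θ⟩⟨θ|)` acts on the factors satisfying `p`, and the other factors are bounded by classicality
of `E`. -/
theorem exists_smoothing_term (hK : IsKraus (classicalKraus c L) E) {θ : EuclideanSpace ℂ d}
    (hE1 : (E (ketBra θ)).trace = 1)
    {ι : Type*} [Fintype ι] [DecidableEq ι] (p : ι → Prop) [DecidablePred p] {t η : ℝ}
    {M : Matrix ({i // p i} → X × B) ({i // p i} → X × B) ℂ}
    (hM : (t • tensorPow {i // p i} ((1 : Matrix X X ℂ) ⊗ₖ traceFst (E (ketBra θ)))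
      - M * tensorPow {i // p i} (E (ketBra θ)) * Mᴴ).PosSemidef)
    (hMη : ∀ A : Matrix ({i // p i} → X × B) ({i // p i} → X × κ) ℂ,
      A * Aᴴ = tensorPow {i // p i} (E (ketBra θ)) → frobSq (M * A - A) ≤ η)
    (β : ({i // ¬p i} → d) → ℂ) {A : Matrix (ι → X × B) (ι → X × κ) ℂ}
    (hA : A = krausPow ι (classicalKraus c L)
      fun w => (∏ i : {i // p i}, θ (w i)) * β fun i => w i) :
    ∃ A' : Matrix (ι → X × B) (ι → X × κ) ℂ,
      (t • idTrace (A * Aᴴ) - A' * A'ᴴ).PosSemidef ∧ frobSq (A' - A) ≤ η * frobSq A := by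
  set K := classicalKraus c L with hKdef
  set S := E (ketBra θ) with hS
  set Aα := tensorPow {i // p i} (krausApply K θ) with hAα
  set Aβ := krausPow {i // ¬p i} K β with hAβ
  have hAsplit : A = (Aα ⊗ₖ Aβ).submatrix (splitIdx p (X × B)) (splitIdx p (X × κ)) := by
    rw [hA, krausPow_split p (fun v => ∏ i, θ (v i)) β, krausPow_prod]
  have hαα : Aα * Aαᴴ = tensorPow {i // p i} S := by
    rw [hAα, ← tensorPow_conjTranspose, ← tensorPow_mul, ← map_ketBra hK]
  have hα1 : frobSq Aα = 1 := by
    have h : ((frobSq Aα : ℝ) : ℂ) = 1 := by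
      rw [← trace_mul_conjTranspose, hαα, trace]
      simp only [diag_apply, tensorPow, of_apply]
      rw [← Fintype.prod_sum fun (_ : {i // p i}) y => S y y]
      rw [trace] at hE1
      simp only [diag_apply] at hE1
      simp [hE1]
    exact_mod_cast h
  have hsq : ∀ (Y : Matrix ({i // p i} → X × B) ({i // p i} → X × κ) ℂ)
      (Z : Matrix ({i // ¬p i} → X × B) ({i // ¬p i} → X × κ) ℂ),
      ((Y ⊗ₖ Z).submatrix (splitIdx p (X × B)) (splitIdx p (X × κ))) *
        ((Y ⊗ₖ Z).submatrix (splitIdx p (X × B)) (splitIdx p (X × κ)))ᴴ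
      = ((Y * Yᴴ) ⊗ₖ (Z * Zᴴ)).submatrix (splitIdx p (X × B)) (splitIdx p (X × B)) := by
    intro Y Z
    rw [conjTranspose_submatrix, submatrix_mul_equiv, conjTranspose_kronecker, mul_kronecker_mul]
  refine ⟨((M * Aα) ⊗ₖ Aβ).submatrix (splitIdx p (X × B)) (splitIdx p (X × κ)), ?_, ?_⟩
  · have hβ := posSemidef_idTrace_sub_krausPow (ι := {i // ¬p i}) c L β
    rw [← hKdef, ← hAβ] at hβ
    have hββ : (Aβ * Aβᴴ).PosSemidef := posSemidef_self_mul_conjTranspose _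
    have hid : (idTrace (Aβ * Aβᴴ)).PosSemidef := by simpa using hβ.add hββ
    have hMS : (M * tensorPow {i // p i} S * Mᴴ).PosSemidef := by
      rw [← hαα]
      exact (posSemidef_self_mul_conjTranspose _).mul_mul_conjTranspose_same M
    -- `t G ⊗ H - M S Mᴴ ⊗ ω = (t G - M S Mᴴ) ⊗ H + M S Mᴴ ⊗ (H - ω)`
    have e : t • idTrace (A * Aᴴ) - ((M * Aα) ⊗ₖ Aβ).submatrix (splitIdx p (X × B))
          (splitIdx p (X × κ)) * (((M * Aα) ⊗ₖ Aβ).submatrix (splitIdx p (X × B))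
          (splitIdx p (X × κ)))ᴴ
        = ((t • tensorPow {i // p i} ((1 : Matrix X X ℂ) ⊗ₖ traceFst S)
            - M * tensorPow {i // p i} S * Mᴴ) ⊗ₖ idTrace (Aβ * Aβᴴ)
          + (M * tensorPow {i // p i} S * Mᴴ) ⊗ₖ (idTrace (Aβ * Aβᴴ) - Aβ * Aβᴴ)).submatrix
            (splitIdx p (X × B)) (splitIdx p (X × B)) := by
      have e1 : M * Aα * (M * Aα)ᴴ = M * tensorPow {i // p i} S * Mᴴ := by
        rw [conjTranspose_mul, ← Matrix.mul_assoc, Matrix.mul_assoc M, hαα]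
      rw [hAsplit, hsq, hsq, idTrace_split, hαα, idTrace_tensorPow, e1]
      ext y y'
      simp only [Matrix.sub_apply, Matrix.smul_apply, submatrix_apply, Matrix.add_apply,
        kroneckerMap_apply, Complex.real_smul]
      ring
    rw [e]
    exact ((hM.kronecker hid).add (hMS.kronecker hβ)).submatrix _
  · have e : ((M * Aα) ⊗ₖ Aβ).submatrix (splitIdx p (X × B)) (splitIdx p (X × κ)) - A
        = ((M * Aα - Aα) ⊗ₖ Aβ).submatrix (splitIdx p (X × B)) (splitIdx p (X × κ)) := by
      rw [hAsplit]
      ext y k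
      simp only [Matrix.sub_apply, submatrix_apply, kroneckerMap_apply]
      ring
    rw [e, frobSq_submatrix, frobSq_kronecker, hAsplit, frobSq_submatrix, frobSq_kronecker, hα1,
      one_mul]
    exact mul_le_mul_of_nonneg_right (hMη Aα hαα) (frobSq_nonneg _)

/-- Smoothing the whole output state, at the price of a factor `n.choose r`. -/
theorem exists_smoothing_output (hK : IsKraus (classicalKraus c L) E) (htp : IsTracePreserving E)
    {n r : ℕ} (hr : r ≤ n) {θ : EuclideanSpace ℂ d} (hθ : ‖θ‖ = 1)
    (hE1 : (E (ketBra θ)).trace = 1)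
    {Ψ : EuclideanSpace ℂ (Fin n → d)} (hΨ : ‖Ψ‖ = 1)
    (hΨmem : Ψ ∈ Submodule.span ℂ (almostProductVectors n θ (n - r))) {t η : ℝ}
    (hM : ∀ (ι : Type) [Fintype ι] [DecidableEq ι], Fintype.card ι = n - r →
      ∃ M : Matrix (ι → X × B) (ι → X × B) ℂ,
        (t • tensorPow ι ((1 : Matrix X X ℂ) ⊗ₖ traceFst (E (ketBra θ)))
          - M * tensorPow ι (E (ketBra θ)) * Mᴴ).PosSemidef ∧
        ∀ A : Matrix (ι → X × B) (ι → X × κ) ℂ,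
          A * Aᴴ = tensorPow ι (E (ketBra θ)) → frobSq (M * A - A) ≤ η) :
    ∃ (A' : Matrix (Fin n → X × B) (Fin n → X × κ) ℂ) (σ : Matrix (Fin n → B) (Fin n → B) ℂ),
      σ.PosSemidef ∧ σ.trace = 1 ∧
      ((n.choose r * t : ℝ) • ((1 : Matrix (Fin n → X) (Fin n → X) ℂ) ⊗ₖ σ)
        - (A' * A'ᴴ).submatrix (prodIdx (Fin n) X B).symm (prodIdx (Fin n) X B).symm).PosSemidef ∧
      frobSq (A' - krausPow (Fin n) (classicalKraus c L) Ψ) ≤ n.choose r * η := by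
  set K := classicalKraus c L with hKdef
  obtain ⟨β, hsum, hnorm⟩ := exists_decomposition hθ hr hΨmem
  set 𝒯 := Finset.powersetCard r (Finset.univ : Finset (Fin n)) with h𝒯
  have hcard : 𝒯.card = n.choose r := by rw [h𝒯, Finset.card_powersetCard, Finset.card_fin]
  let Φ : Finset (Fin n) → (Fin n → d) → ℂ := fun T w =>
    (∏ i : {i // i ∉ T}, θ (w i)) * β T fun i => w i
  let A : Finset (Fin n) → Matrix (Fin n → X × B) (Fin n → X × κ) ℂ := fun T =>
    krausPow (Fin n) K (Φ T)
  have hAsum : krausPow (Fin n) K Ψ = ∑ T ∈ 𝒯, A T := by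
    rw [← krausPow_sum]
    congr 1
    ext w
    exact hsum w
  have hA1 : ∑ T ∈ 𝒯, frobSq (A T) = 1 := by
    rw [hΨ, one_pow] at hnorm
    rw [← hnorm]
    exact Finset.sum_congr rfl fun T _ => frobSq_krausPow hK htp _
  have hterm : ∀ T, ∃ A' : Matrix (Fin n → X × B) (Fin n → X × κ) ℂ, T ∈ 𝒯 →
      (t • idTrace (A T * (A T)ᴴ) - A' * A'ᴴ).PosSemidef ∧
        frobSq (A' - A T) ≤ η * frobSq (A T) := by
    intro T
    by_cases hT : T ∈ 𝒯
    · obtain ⟨M, h1, h2⟩ := hM {i // i ∉ T} (by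
        have hTc := (Finset.mem_powersetCard.1 hT).2
        rw [Fintype.card_subtype_compl, Fintype.card_coe, hTc, Fintype.card_fin])
      obtain ⟨A', h3⟩ := exists_smoothing_term hK hE1 (fun i => i ∉ T) h1 h2 (β T) (A := A T) rfl
      exact ⟨A', fun _ => h3⟩
    · exact ⟨0, fun h => absurd h hT⟩
  choose A' hA' using hterm
  set ρ := ∑ T ∈ 𝒯, A T * (A T)ᴴ with hρ
  have hρpos : ρ.PosSemidef := posSemidef_sum _ fun T _ => posSemidef_self_mul_conjTranspose _
  set e := (prodIdx (Fin n) X B).symm with he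
  refine ⟨∑ T ∈ 𝒯, A' T, traceFst (ρ.submatrix e e), traceFst_posSemidef (hρpos.submatrix e),
    ?_, ?_, ?_⟩
  · rw [trace_traceFst]
    have h1 : (ρ.submatrix e e).trace = ρ.trace := by
      simp only [trace, diag_apply, submatrix_apply]
      exact e.sum_comp fun y => ρ y y
    rw [h1, hρ, trace_sum]
    simp only [trace_mul_conjTranspose, ← Complex.ofReal_sum, hA1, Complex.ofReal_one]
  · rw [← idTrace_submatrix, hρ, idTrace_sum]
    have h1 := posSemidef_card_smul_sum_sub 𝒯 A'
    have h2 : (∑ T ∈ 𝒯, (t • idTrace (A T * (A T)ᴴ) - A' T * (A' T)ᴴ)).PosSemidef :=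
      posSemidef_sum _ fun T hT => (hA' T hT).1
    rw [hcard] at h1
    have h3 := (h1.add (h2.smul (Nat.cast_nonneg (α := ℝ) (n.choose r)))).submatrix e
    have e1 : ((n.choose r * t : ℝ) • (∑ T ∈ 𝒯, idTrace (A T * (A T)ᴴ)).submatrix e e
        - ((∑ T ∈ 𝒯, A' T) * (∑ T ∈ 𝒯, A' T)ᴴ).submatrix e e)
        = ((n.choose r : ℝ) • ∑ T ∈ 𝒯, A' T * (A' T)ᴴ
            - (∑ T ∈ 𝒯, A' T) * (∑ T ∈ 𝒯, A' T)ᴴ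
          + (n.choose r : ℝ) • ∑ T ∈ 𝒯, (t • idTrace (A T * (A T)ᴴ) - A' T * (A' T)ᴴ)).submatrix
            e e := by
      rw [Finset.sum_sub_distrib, ← Finset.smul_sum, smul_sub, smul_smul]
      ext y y'
      simp only [Matrix.sub_apply, Matrix.smul_apply, submatrix_apply, Matrix.add_apply]
      ring
    rw [e1]
    exact h3
  · rw [hAsum, ← Finset.sum_sub_distrib]
    refine (frobSq_sum_le _ _).trans ?_
    rw [hcard]
    refine mul_le_mul_of_nonneg_left ?_ (Nat.cast_nonneg _)
    calc ∑ T ∈ 𝒯, frobSq (A' T - A T) ≤ ∑ T ∈ 𝒯, η * frobSq (A T) :=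
          Finset.sum_le_sum fun T hT => (hA' T hT).2
      _ = η := by rw [← Finset.mul_sum, hA1, mul_one]

end

/-! ### The smooth min-entropy -/

section
variable {X B : Type*} [Fintype X] [DecidableEq X] [Fintype B] [DecidableEq B]

/-- The asymptotic equipartition property in its one-shot form: smoothing a tensor power of a state
`S ≤ 1 ⊗ S_B`. The exponent `s` is free, and the conditional entropy of `S` enters through the mean
of the logarithm of the likelihood ratio. -/
theorem exists_smoothing_tensorPow_state {S : Matrix (X × B) (X × B) ℂ} (hS : S.PosSemidef)
    (hS1 : S.trace = 1) (hle : ((1 : Matrix X X ℂ) ⊗ₖ traceFst S - S).PosSemidef) :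
    (1 : ℝ) ≤ (traceSnd S).rank ∧
    vonNeumannEntropy S - vonNeumannEntropy (traceFst S) ≤ Real.logb 2 (traceSnd S).rank ∧
    ∀ {s t : ℝ}, 0 ≤ s → s ≤ 1 / 2 → s * Real.log (4 * (traceSnd S).rank) ≤ 1 → 0 < t →
      ∀ (ι : Type) [Fintype ι] [DecidableEq ι], ∃ M : Matrix (ι → X × B) (ι → X × B) ℂ,
        (t • tensorPow ι ((1 : Matrix X X ℂ) ⊗ₖ traceFst S)
          - M * tensorPow ι S * Mᴴ).PosSemidef ∧
        ∀ {κ : Type _} [Fintype κ] (A : Matrix (ι → X × B) κ ℂ), A * Aᴴ = tensorPow ι S →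
          frobSq (M * A - A) ≤ t ^ (-s) * Real.exp
            (s * (-(Real.log 2 * (vonNeumannEntropy S - vonNeumannEntropy (traceFst S))))
              + 3 / 4 * (s * Real.log (4 * (traceSnd S).rank)) ^ 2) ^ Fintype.card ι := by
  obtain ⟨U, V, p, q, hU, hU', hV, hV', hp, hq, hsupp, hUS, hVG, hw1, hφ, hφinv, hlog⟩ :=
    exists_likelihood_ratio hS hS1 hle (traceFst_posSemidef hS)
  let w : (X × B) × (X × B) → ℝ := fun z => p z.1 * ‖(Vᴴ * U) z.2 z.1‖ ^ 2
  let φ : (X × B) × (X × B) → ℝ := fun z => p z.1 / q z.2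
  have hw : ∀ z, 0 ≤ w z := fun z => mul_nonneg (hp _) (by positivity)
  have hpos : ∀ z, w z ≠ 0 → 0 < φ z := by
    intro z hz
    have h1 : p z.1 ≠ 0 := fun h => hz (by simp only [w, h, zero_mul])
    have h2 : q z.2 ≠ 0 := fun h => hz (hsupp _ _ h)
    exact div_pos (lt_of_le_of_ne (hp _) h1.symm) (lt_of_le_of_ne (hq _) h2.symm)
  have hw1' : ∑ z, w z = 1 := by rw [Fintype.sum_prod_type]; exact hw1
  have hφ' : ∑ z, w z * φ z ≤ 1 := by rw [Fintype.sum_prod_type]; exact hφ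
  have hφinv' : ∑ z, w z * (φ z)⁻¹ ≤ (traceSnd S).rank := by
    rw [Fintype.sum_prod_type]; exact hφinv
  have hlog' : ∑ z, w z * Real.log (φ z)
      = -(Real.log 2 * (vonNeumannEntropy S - vonNeumannEntropy (traceFst S))) := by
    rw [Fintype.sum_prod_type]; exact hlog
  have hrank : (1 : ℝ) ≤ (traceSnd S).rank := by
    obtain ⟨z, -, hz⟩ := Finset.exists_ne_zero_of_sum_ne_zero (hw1' ▸ one_ne_zero)
    have h1 : 0 < ∑ z, w z * (φ z)⁻¹ := by
      refine Finset.sum_pos' (fun z' _ => ?_) ⟨z, Finset.mem_univ _,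
        mul_pos (lt_of_le_of_ne (hw z) (Ne.symm hz)) (inv_pos.2 (hpos z hz))⟩
      exact mul_nonneg (hw z') (inv_nonneg.2 (div_nonneg (hp _) (hq _)))
    have h2 : (0 : ℝ) < (traceSnd S).rank := h1.trans_le hφinv'
    exact_mod_cast h2
  refine ⟨hrank, ?_, ?_⟩
  · have h := sum_mul_log_le hw (φ := fun z => (φ z)⁻¹) (fun z hz => inv_pos.2 (hpos z hz)) hw1'
      hφinv'
    simp only [Real.log_inv, mul_neg, Finset.sum_neg_distrib, hlog', neg_neg] at h
    rw [Real.logb, le_div_iff₀ (Real.log_pos (by norm_num))]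
    linarith
  · intro s t hs0 hs1 hs2 ht ι _ _
    obtain ⟨M, hM, hMA⟩ := exists_smoothing_tensorPow (ι := ι) hU hU' hV hV' hp hq hsupp hs0 hUS
      hVG ht
    refine ⟨M, hM, fun A hA => (hMA A hA).trans ?_⟩
    have h := moment_le_exp hw hpos hw1' hφ' hφinv' hrank hs0 hs1 hs2
    rw [hlog', Fintype.sum_prod_type] at h
    refine mul_le_mul_of_nonneg_left (pow_le_pow_left₀ ?_ h _) (Real.rpow_nonneg ht.le _)
    exact Finset.sum_nonneg fun a _ => Finset.sum_nonneg fun b _ =>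
      mul_nonneg (hw (a, b)) (Real.rpow_nonneg (div_nonneg (hp _) (hq _)) _)

theorem submatrix_mul_conjTranspose {m k l : Type*} [Fintype k] (A : Matrix m k ℂ) (f : l → m) :
    (A * Aᴴ).submatrix f f = A.submatrix f (Equiv.refl k) * (A.submatrix f (Equiv.refl k))ᴴ :=
  rfl

end
end AlmostProduct

open AlmostProduct Matrix in
theorem mainTheorem8 {d X B : Type*} [Fintype d] [DecidableEq d] [Fintype X] [DecidableEq X]
    [Fintype B] [DecidableEq B]
    (n r : ℕ) (hn : 0 < n) (hr : (r : ℝ) ≤ 1 / 2 * n)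
    (θ : EuclideanSpace ℂ d) (hθ : ‖θ‖ = 1)
    (Ψ : EuclideanSpace ℂ (Fin n → d)) (hΨ : ‖Ψ‖ = 1)
    (hΨmem : Ψ ∈ symSubspaceAlong n θ (n - r))
    (E : Matrix d d ℂ →ₗ[ℂ] Matrix (X × B) (X × B) ℂ)
    (hcp : IsCPM E) (htp : IsTracePreserving E) (hcl : IsClassicalOnFst E)
    (ε : ℝ) (hε : 0 ≤ ε) :
    ((1 / n : ℝ) : EReal) * smoothMinEntropy ε (splitPow (tensorPowMap E n (ketBra Ψ)))
      ≥ ((vonNeumannEntropy (E (ketBra θ)) - vonNeumannEntropy (traceFst (E (ketBra θ))) : ℝ) :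
          EReal)
        - symErrorTerm (maxEntropy (traceSnd (E (ketBra θ)))) n r ε := by
  have hn' : (0 : ℝ) < n := by exact_mod_cast hn
  have hrn : r ≤ n := by
    have : (r : ℝ) ≤ n := by linarith
    exact_mod_cast this
  -- the case `ε = 0`, in which the error term is infinite
  rcases hε.eq_or_lt with h0 | hε0
  · rw [symErrorTerm, if_pos h0.symm, EReal.sub_top]
    exact bot_le
  obtain ⟨c, F, hF, hEF⟩ := hcl
  choose L hL using fun x => exists_isKraus (hF x)
  have hK : IsKraus (classicalKraus c L) E := isKraus_classicalKraus hL hEF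
  set S := E (ketBra θ) with hSdef
  have hS : S.PosSemidef := by
    rw [hSdef, map_ketBra hK]; exact posSemidef_self_mul_conjTranspose _
  have hS1 : S.trace = 1 := by
    rw [hSdef, htp, ← sum_star_mul_self hθ, trace]
    exact Finset.sum_congr rfl fun a _ => mul_comm _ _
  have hle : ((1 : Matrix X X ℂ) ⊗ₖ traceFst S - S).PosSemidef := by
    have h := posSemidef_one_kronecker_sub (Q := fun x => ketBra (c x))
      (ω := fun x => F x (ketBra θ)) (fun x => posSemidef_vecMulVec_self_star (c x).ofLp)
      (fun x => by rw [map_ketBra (hL x)]; exact posSemidef_self_mul_conjTranspose _)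
      (by ext y y'; rw [Matrix.sum_apply]; exact sum_basis_mul_star c y y')
      (fun x => sum_star_mul_basis c x)
    rwa [← hEF] at h
  obtain ⟨hD, hH, hsmooth⟩ := exists_smoothing_tensorPow_state hS hS1 hle
  set H := vonNeumannEntropy S - vonNeumannEntropy (traceFst S) with hHdef
  set D : ℝ := ((traceSnd S).rank : ℝ) with hDdef
  set Λ : ℝ := 2 * Real.logb 2 (4 / ε) / n + binaryEntropy ((r : ℝ) / n) with hΛ
  have hlD : 0 ≤ Real.logb 2 D := Real.logb_nonneg (by norm_num) hD
  set A := krausPow (Fin n) (classicalKraus c L) Ψ with hA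
  set e := (prodIdx (Fin n) X B).symm with he
  have hρ : splitPow (tensorPowMap E n (ketBra Ψ)) = (A * Aᴴ).submatrix e e := by
    rw [tensorPowMap_ketBra hK]; rfl
  have hA1 : frobSq A = 1 := by
    rw [hA, frobSq_krausPow hK htp, ← EuclideanSpace.norm_sq_eq, hΨ, one_pow]
  rw [hρ]
  suffices hgoal : ((n * (H - (5 / 2 * Real.logb 2 D + 4) * √Λ) : ℝ) : EReal)
      ≤ smoothMinEntropy ε ((A * Aᴴ).submatrix e e) by
    rw [symErrorTerm, if_neg hε0.ne', ge_iff_le, ← EReal.coe_sub]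
    calc ((H - (5 / 2 * Real.logb 2 D + 4) * √Λ : ℝ) : EReal)
        = ((1 / n : ℝ) : EReal) * ((n * (H - (5 / 2 * Real.logb 2 D + 4) * √Λ) : ℝ) : EReal) := by
          rw [← EReal.coe_mul]
          congr 1
          field_simp
      _ ≤ _ := mul_le_mul_of_nonneg_left hgoal (EReal.coe_nonneg.2 (by positivity))
  have hAApos : ((A * Aᴴ).submatrix e e).PosSemidef :=
    (posSemidef_self_mul_conjTranspose A).submatrix e
  have hAAtr : ((A * Aᴴ).submatrix e e).trace = 1 := by
    have h1 : ((A * Aᴴ).submatrix e e).trace = (A * Aᴴ).trace := by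
      simp only [trace, diag_apply, submatrix_apply]
      exact e.sum_comp fun y => (A * Aᴴ) y y
    rw [h1, trace_mul_conjTranspose, hA1, Complex.ofReal_one]
  have hσ := traceFst_posSemidef hAApos
  have hσ1 := (trace_traceFst ((A * Aᴴ).submatrix e e)).trans hAAtr
  -- for `ε ≥ 1` the smoothing ball contains the zero operator
  rcases le_or_gt 1 ε with hε1 | hε1
  · have h0 : (0 : Matrix _ _ ℂ) ∈ smoothingBall ε ((A * Aᴴ).submatrix e e) := by
      refine ⟨PosSemidef.zero, ?_, ?_⟩
      · have h := traceNorm_sub_le (A.submatrix e (Equiv.refl _)) 0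
        rw [← submatrix_mul_conjTranspose, Matrix.zero_mul, zero_sub (A.submatrix _ _)] at h
        have h2 : frobSq (-A.submatrix e (Equiv.refl _)) = 1 := by
          have h3 : frobSq (-A.submatrix e (Equiv.refl _))
              = frobSq (A.submatrix e (Equiv.refl _)) := by
            simp [frobSq]
          rw [h3, frobSq_submatrix, hA1]
        rw [h2, frobSq_submatrix, hA1, Real.sqrt_one, one_mul] at h
        have h4 : √(frobSq (0 : Matrix ((Fin n → X) × (Fin n → B))
            (Fin n → X × (B × Fin (Fintype.card d))) ℂ)) = 0 := by
          simp [frobSq]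
        rw [h4, zero_add] at h
        rw [hAAtr, Complex.one_re, one_mul]
        exact h.trans hε1
      · rw [hAAtr]; simp
    have h := le_smoothMinEntropy
      (t := 2 ^ (-(n * (H - (5 / 2 * Real.logb 2 D + 4) * √Λ)))) hσ hσ1 h0 (by positivity) (by
        rw [sub_zero]
        exact (PosSemidef.one.kronecker hσ).smul (Real.rpow_nonneg (by norm_num) _))
    rwa [Real.logb_rpow (by norm_num) (by norm_num), neg_neg] at h
  have hlε : 2 ≤ Real.logb 2 (4 / ε) := by
    rw [Real.le_logb_iff_rpow_le (by norm_num) (by positivity), le_div_iff₀ hε0]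
    norm_num
    linarith
  have hp0 : (0 : ℝ) ≤ (r : ℝ) / n := by positivity
  have hp1 : (r : ℝ) / n ≤ 1 / 2 := by rw [div_le_iff₀ hn']; exact hr
  have hh0 : 0 ≤ binaryEntropy ((r : ℝ) / n) := by
    linarith [two_mul_le_binaryEntropy hp0 hp1]
  have hhΛ : binaryEntropy ((r : ℝ) / n) ≤ Λ := by
    have : 0 ≤ 2 * Real.logb 2 (4 / ε) / n := by positivity
    linarith
  -- for large `Λ` the bound is at most zero, and no smoothing is needed
  rcases le_or_gt (2 / 5) (√Λ) with hΛ1 | hΛ1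
  · have hball : (A * Aᴴ).submatrix e e ∈ smoothingBall ε ((A * Aᴴ).submatrix e e) := by
      refine ⟨hAApos, ?_, le_rfl⟩
      have h := traceNorm_sub_le (A.submatrix e (Equiv.refl _)) (A.submatrix e (Equiv.refl _))
      rw [← submatrix_mul_conjTranspose] at h
      refine h.trans ?_
      have h2 : √(frobSq (A.submatrix e (Equiv.refl _) - A.submatrix e (Equiv.refl _))) = 0 := by
        simp [frobSq]
      rw [h2, zero_mul, hAAtr, Complex.one_re, one_mul]
      exact hε
    have h := le_smoothMinEntropy (t := 1) hσ hσ1 hball one_pos (by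
      rw [one_smul, ← idTrace_submatrix]
      exact (posSemidef_idTrace_sub_krausPow c L Ψ).submatrix e)
    refine le_trans (EReal.coe_le_coe_iff.2 ?_) h
    rw [Real.logb_one, neg_zero]
    have h1 : H - (5 / 2 * Real.logb 2 D + 4) * √Λ ≤ 0 := by nlinarith
    exact mul_nonpos_of_nonneg_of_nonpos hn'.le h1
  have hΛ0 : 0 ≤ Λ := hh0.trans hhΛ
  have hl4D : 4 / 5 ≤ Real.log (4 * D) := by
    have h1 : Real.log 4 ≤ Real.log (4 * D) := Real.log_le_log (by norm_num) (by linarith)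
    have h2 : Real.log 4 = 2 * Real.log 2 := by
      rw [show (4 : ℝ) = 2 ^ 2 by norm_num, Real.log_pow]; norm_num
    linarith [Real.log_two_gt_d9]
  have hsl : √Λ / Real.log (4 * D) * Real.log (4 * D) = √Λ := div_mul_cancel₀ _ (by linarith)
  -- smoothing at the level `t`, with a deviation of `(2 log D + 3) √Λ` per factor
  set t : ℝ := 2 ^ (-(((n - r : ℕ) : ℝ) * H - n * (2 * Real.logb 2 D + 3) * √Λ)) with ht
  have ht0 : 0 < t := by positivity
  have hs1 : √Λ / Real.log (4 * D) ≤ 1 / 2 := by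
    rw [div_le_iff₀ (by linarith)]; linarith
  obtain ⟨A', σ, hσ', hσ1', hpos, hfrob⟩ := exists_smoothing_output (r := r) hK htp hrn hθ hS1 hΨ
    hΨmem.2 (t := t) (fun ι _ _ hι => by
      obtain ⟨M, h1, h2⟩ := hsmooth (s := √Λ / Real.log (4 * D)) (t := t)
        (div_nonneg (Real.sqrt_nonneg _) (by linarith)) hs1 (by rw [hsl]; linarith) ht0 ι
      rw [hι, hsl] at h2
      exact ⟨M, h1, fun A hA => h2 A hA⟩)
  rw [← mul_assoc] at hfrob
  have hclose := hfrob.trans (choose_mul_failure_le (H := H) hn hrn hε0 hD hΛ hΛ0)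
  obtain ⟨γ, hγ0, hγ1, hball⟩ := exists_mem_smoothingBall (a := A.submatrix e (Equiv.refl _))
    (b := A'.submatrix e (Equiv.refl _)) hε (by rw [frobSq_submatrix, hA1])
    (by
      have h1 : A'.submatrix e (Equiv.refl _) - A.submatrix e (Equiv.refl _)
          = (A' - A).submatrix e (Equiv.refl _) := rfl
      rw [h1, frobSq_submatrix]
      exact hclose)
  rw [← submatrix_mul_conjTranspose, ← submatrix_mul_conjTranspose] at hball
  have hN : (0 : ℝ) < n.choose r := by exact_mod_cast Nat.choose_pos hrn
  -- shrinking by `γ ≤ 1` preserves the operator bound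
  have h := le_smoothMinEntropy (t := n.choose r * t) hσ' hσ1' hball (by positivity) (by
    have h1 := hpos.add (((posSemidef_self_mul_conjTranspose A').submatrix e).smul
      (sub_nonneg.2 hγ1))
    have h2 : ∀ Y Z : Matrix ((Fin n → X) × (Fin n → B)) ((Fin n → X) × (Fin n → B)) ℂ,
        Y - Z + (1 - γ) • Z = Y - γ • Z := by
      intro Y Z
      rw [sub_smul, one_smul]
      abel
    rwa [h2] at h1)
  exact le_trans (EReal.coe_le_coe_iff.2 (le_neg_logb_choose_mul hn hr hD hH hhΛ)) h
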